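/- A function $f:\mathbb R_{\ge 0}\to\mathbb R_{\ge 0}$ is called approximately invertible with parameters $\theta,\theta',\theta''>1$ if for all $x,y\ge 0$: (i) $f(x)+f(y)\le f(x+y)$ (super-additivity), (ii) $f(\theta' y)\ge \theta f(y)$, and (iii) $f\big(y/(4\sqrt{\theta}\,\theta')\big)\ge f(y)/\theta''$. For an integer $s\ge 1$ let $c_f[s]$ be the smallest number $c\ge 0$ such that $$f(y_1+\cdots+y_s)\le \frac{c}{s}\Big(\sqrt{f(y_1)}+\cdots+\sqrt{f(y_s)}\Big)^2\qquad\text{for all } y_1,\dots,y_s\ge 0 .$$ In the coordinator model, each of $s$ servers $j=1,\dots,s$ holds a vector $x(j)\in D^n$, where $D\subseteq\mathbb R_{\ge 0}$ is the set of admissible entries; the coordinator has no input, and all parties share a source of randomness. In a two-round protocol every server sends a message to the coordinator depending on its input and the shared randomness; the coordinator sends to every server a (possibly different) message depending on the messages received and the shared randomness; every server sends a second message depending on its input, the message it received and the shared randomness; finally the coordinator outputs a real number computed from all the messages it received and the shared randomness. Messages are finite sequences of words, i.e. of symbols of a fixed alphabet $W$ that is large enough to hold an index from $\{1,\dots,n\}$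 as well as an element of $D$ (that is, $\{1,\dots,n\}$ and $D$ each inject into $W$; for example $W=\{0,1\}^w$ whenever $n\le 2^w$ and $|D|\le 2^w$). The communication is the total number of words sent, in both rounds and in both directions. Theorem. There are absolute constants $a,b,C>0$ such that the following holds. Let $f:\mathbb R_{\ge 0}\to\mathbb R_{\ge 0}$ be increasing (in the weak sense) and approximately invertible with parameters $\theta,\theta',\theta''>1$ (in particular super-additive). Let $n\ge 2$, $s\ge 1$, $0<\varepsilon<1$, let $D\subseteq\mathbb R_{\ge0}$ be any set, and let $W$ be any word alphabet as above. Put $$A=\left\lceil a\,\frac{\log(s\theta'')}{\log\theta}\right\rceil,\qquad B=\left\lceil b\,\frac{\log(s^2\theta''^2)}{\log\theta}\right\rceil .$$ Then there is a two-round protocol which, on all inputs and for all outcomes of the randomness, uses at most $$C\left(\frac{c_f[s]}{\varepsilon^2}\cdot c_f[A B]\cdot A B\cdot\sqrt{\theta}\cdot\theta''^3\cdot\log^4 n+\frac{s}{\varepsilon^2}\cdot\log^2 n\cdot\theta''^4\right)$$ words of communication and which, for every input $x(1),\dots,x(s)\in D^n$ with $x=x(1)+\cdots+x(s)$, outputs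 with probability at least $9/10$ a number in the interval $\big[(1-\varepsilon)\sum_{i=1}^n f(x_i),\,(1+\varepsilon)\sum_{i=1}^n f(x_i)\big]$. -/

import Mathlib

open MeasureTheory
open scoped NNReal ENNReal

/-- Approximate invertibility of a non-negative function on the non-negative reals. -/
structure ApproxInvertible (f : ℝ≥0 → ℝ≥0) (θ θ' θ'' : ℝ≥0) : Prop where
  one_lt_θ : 1 < θ
  one_lt_θ' : 1 < θ'
  one_lt_θ'' : 1 < θ''
  superadditive : ∀ x y, f x + f y ≤ f (x + y)
  scale_up : ∀ y, θ * f y ≤ f (θ' * y)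
  scale_down : ∀ y, f y / θ'' ≤ f (y / (4 * NNReal.sqrt θ * θ'))

/-- The parameter `c_f[s]`: the smallest non-negative number `c` such that
`f (y₁ + ⋯ + yₛ) ≤ (c / s) (√f(y₁) + ⋯ + √f(yₛ))²` for all `y₁, …, yₛ ≥ 0`. -/
noncomputable def cf (f : ℝ≥0 → ℝ≥0) (s : ℕ) : ℝ≥0 :=
  sInf {c : ℝ≥0 | ∀ y : Fin s → ℝ≥0,
    f (∑ j, y j) ≤ c / s * (∑ j, NNReal.sqrt (f (y j))) ^ 2}

/-- A two-round protocol in the coordinator model with `s` servers, each holding a vector of `n`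
entries taken from `D`. Messages are finite sequences of words from the alphabet `W`; `Ω` is the
space of the randomness shared by the servers and the coordinator.

Round 1: server `j` sends `first ω j (x j)` to the coordinator, which has no input and answers
server `j` with `query ω m₁ j`, where `m₁` is the family of all first messages.
Round 2: server `j` sends `second ω j (x j) q`, where `q` is the answer it received.
The coordinator then computes `output ω m₁ m₂` from all the messages it received. -/
structure TwoRoundProtocol (s n : ℕ) (D : Set ℝ≥0) (W Ω : Type) where
  first : Ω → Fin s → (Fin n → D) → List W
  query : Ω → (Fin s → List W) → Fin s → List W
  second : Ω → Fin s → (Fin n → D) → List W → List W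
  output : Ω → (Fin s → List W) → (Fin s → List W) → ℝ

namespace TwoRoundProtocol

variable {s n : ℕ} {D : Set ℝ≥0} {W Ω : Type}

/-- The messages of the servers in the first round, on input `x` and randomness `ω`. -/
def msg₁ (P : TwoRoundProtocol s n D W Ω) (ω : Ω) (x : Fin s → Fin n → D) : Fin s → List W :=
  fun j => P.first ω j (x j)

/-- The messages of the coordinator to the servers. -/
def reply (P : TwoRoundProtocol s n D W Ω) (ω : Ω) (x : Fin s → Fin n → D) : Fin s → List W :=
  P.query ω (P.msg₁ ω x)

/-- The messages of the servers in the second round. -/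
def msg₂ (P : TwoRoundProtocol s n D W Ω) (ω : Ω) (x : Fin s → Fin n → D) : Fin s → List W :=
  fun j => P.second ω j (x j) (P.reply ω x j)

/-- The value computed by the coordinator at the end of the protocol. -/
def result (P : TwoRoundProtocol s n D W Ω) (ω : Ω) (x : Fin s → Fin n → D) : ℝ :=
  P.output ω (P.msg₁ ω x) (P.msg₂ ω x)

/-- The total number of words sent, in both directions and in both rounds. -/
def words (P : TwoRoundProtocol s n D W Ω) (ω : Ω) (x : Fin s → Fin n → D) : ℕ :=
  ∑ j, ((P.msg₁ ω x j).length + (P.reply ω x j).length + (P.msg₂ ω x j).length)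

end TwoRoundProtocol

/-- `∑ i, f (x_i)` for the vector `x = x(1) + ⋯ + x(s)` split over the servers. -/
noncomputable def sumOf {s n : ℕ} {D : Set ℝ≥0} (f : ℝ≥0 → ℝ≥0) (x : Fin s → Fin n → D) : ℝ≥0 :=
  ∑ i, f (∑ j, (x j i : ℝ≥0))

/-! Write X = x(1) + ⋯ + x(s), a_i = f(X_i) and F = ∑ a_i. Shared randomness gives coordinate i a
uniform rank u_i, a weight ρ_i = n/(u_i + 1) and a priority a_i ρ_i. Keeping the coordinates of
priority at least τ, each divided by its inclusion probability, estimates F with bias at most τ and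
variance at most 2τF, so τ of order ε²F suffices. F is unknown, but a dyadic τ of that order is
recognised by the sample size crossing K of order 1/ε², and this rule ignores coordinates below the
smallest candidate τ (`exists_good_ranks`).

Since ρ_i has mean H_n, the priorities usually sum to O(F log n), so each coordinate that matters
carries a share of order at least ε²/log n and can be found as a heavy hitter. Server j samples N
entries with probability about proportional to f(x_i(j)) ρ_i. If the servers that rarely sample a
heavy i held more than half of X_i, Cauchy–Schwarz and the inequality defining c_f[s] would
contradict N of order θ'' c_f[s] log² n / (s ε²) (`half_le_sum_good`). Hence the hits give a
Horvitz–Thompson estimate of X_i; clipping them at y/L when testing a value y makes Chernoff's bound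
applicable, and for L = 20 log n all estimates are at most 4X_i, and those at heavy i at least X_i/8
(`measure_bad_samples_le`).

Approximate invertibility converts constant factors in X_i into powers of θ'' in f, so the M top
scores, M of order θ''³ log n / ε², include every heavy coordinate. The second round fetches these
entries exactly (`exists_threshold_protocol`). The cost O(s(1 + N + M)) fits the stated bound
because c_f[AB]·AB·√θ ≥ 1 (`words_bound`). -/

namespace ApproxInvertible

/-! ### Consequences of approximate invertibility, and the parameter `cf`. -/

variable {f : ℝ≥0 → ℝ≥0} {θ θ' θ'' : ℝ≥0}

lemma map_zero (h : ApproxInvertible f θ θ' θ'') : f 0 = 0 := by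
  have := h.superadditive 0 0
  simpa using this

lemma sum_le (h : ApproxInvertible f θ θ' θ'') {ι : Type*} (t : Finset ι) (y : ι → ℝ≥0) :
    ∑ j ∈ t, f (y j) ≤ f (∑ j ∈ t, y j) := by
  classical
  induction t using Finset.induction_on with
  | empty => simp
  | insert a t ha ih =>
    rw [Finset.sum_insert ha, Finset.sum_insert ha]
    exact (add_le_add le_rfl ih).trans (h.superadditive _ _)

/-- The divisor in `scale_down` is at least 4, as √θ and θ' are at least 1. -/
lemma le_mul_map_quarter (h : ApproxInvertible f θ θ' θ'') (hf : Monotone f) (y : ℝ≥0) :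
    f y ≤ θ'' * f (y / 4) := by
  have h1 := h.scale_down y
  have h2 : f (y / (4 * NNReal.sqrt θ * θ')) ≤ f (y / 4) := by
    apply hf
    have hs : 1 ≤ NNReal.sqrt θ := by
      rw [NNReal.le_sqrt_iff_sq_le]; simpa using h.one_lt_θ.le
    have : (4 : ℝ≥0) ≤ 4 * NNReal.sqrt θ * θ' := by
      calc (4 : ℝ≥0) = 4 * 1 * 1 := by norm_num
        _ ≤ 4 * NNReal.sqrt θ * θ' := by gcongr; exact h.one_lt_θ'.le
    gcongr
  have h3 := h1.trans h2
  rw [div_le_iff₀ (by exact lt_trans one_pos h.one_lt_θ'')] at h3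
  rwa [mul_comm]

lemma le_pow_mul_map (h : ApproxInvertible f θ θ' θ'') (hf : Monotone f) (k : ℕ) (y : ℝ≥0) :
    f y ≤ θ'' ^ k * f (y / 4 ^ k) := by
  induction k with
  | zero => simp
  | succ k ih =>
    calc f y ≤ θ'' ^ k * f (y / 4 ^ k) := ih
      _ ≤ θ'' ^ k * (θ'' * f (y / 4 ^ k / 4)) := by gcongr; exact h.le_mul_map_quarter hf _
      _ = θ'' ^ (k + 1) * f (y / 4 ^ (k + 1)) := by rw [div_div, ← pow_succ]; ring

lemma le_pow_mul_map_of_le (h : ApproxInvertible f θ θ' θ'') (hf : Monotone f) (k : ℕ)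
    {y z : ℝ≥0} (hz : y ≤ 4 ^ k * z) : f y ≤ θ'' ^ k * f z := by
  refine (h.le_pow_mul_map hf k y).trans ?_
  gcongr
  apply hf
  rw [div_le_iff₀ (by positivity)]
  rwa [mul_comm]

/-- The inequality defining `cf` holds for `cf` itself. -/
lemma map_sum_le_cf (h : ApproxInvertible f θ θ' θ'') (hf : Monotone f) {s : ℕ} (hs : 1 ≤ s)
    (y : Fin s → ℝ≥0) :
    f (∑ j, y j) ≤ cf f s / s * (∑ j, NNReal.sqrt (f (y j))) ^ 2 := by
  set S := {c : ℝ≥0 | ∀ y : Fin s → ℝ≥0,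
    f (∑ j, y j) ≤ c / s * (∑ j, NNReal.sqrt (f (y j))) ^ 2} with hS
  have hs0 : (0 : ℝ≥0) < s := by exact_mod_cast hs
  have hne : S.Nonempty := by
    -- The largest entry dominates: the sum is at most s ≤ 4^s times it, which costs θ''^s.
    refine ⟨s * θ'' ^ s, fun y => ?_⟩
    have : Nonempty (Fin s) := ⟨⟨0, hs⟩⟩
    obtain ⟨j, -, hj⟩ := Finset.exists_max_image Finset.univ y Finset.univ_nonempty
    have h1 : ∑ j, y j ≤ 4 ^ s * y j := by
      calc ∑ j, y j ≤ ∑ _j : Fin s, y j := Finset.sum_le_sum fun i hi => hj i hi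
        _ = s * y j := by simp
        _ ≤ 4 ^ s * y j := by
          gcongr
          exact_mod_cast (Nat.lt_pow_self (by norm_num : 1 < 4)).le
    have h2 : f (y j) ≤ (∑ j, NNReal.sqrt (f (y j))) ^ 2 := by
      calc f (y j) = (NNReal.sqrt (f (y j))) ^ 2 := by simp
        _ ≤ _ := by
          gcongr
          exact Finset.single_le_sum (f := fun j => NNReal.sqrt (f (y j)))
            (fun _ _ => zero_le) (Finset.mem_univ j)
    calc f (∑ j, y j) ≤ θ'' ^ s * f (y j) := h.le_pow_mul_map_of_le hf s h1
      _ ≤ θ'' ^ s * (∑ j, NNReal.sqrt (f (y j))) ^ 2 := by gcongr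
      _ = s * θ'' ^ s / s * (∑ j, NNReal.sqrt (f (y j))) ^ 2 := by
        rw [mul_div_cancel_left₀ _ hs0.ne']
  -- A closed nonempty set bounded below contains its infimum.
  have hclosed : IsClosed S := by
    simp only [hS, Set.ofPred_forall]
    refine isClosed_iInter fun y => isClosed_le continuous_const ?_
    fun_prop
  exact hclosed.csInf_mem hne (OrderBot.bddBelow _) y

/-- A vector with a single nonzero entry turns the defining inequality into 1 ≤ c/s. This shows that
the factor `cf f (A * B)` in the final bound is at least 1. -/
lemma le_cf (h : ApproxInvertible f θ θ' θ'') (hf : Monotone f) {s : ℕ} (hs : 1 ≤ s)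
    {y : ℝ≥0} (hy : f y ≠ 0) : (s : ℝ≥0) ≤ cf f s := by
  have h1 := h.map_sum_le_cf hf hs (Pi.single ⟨0, hs⟩ y)
  have h2 : ∑ j, NNReal.sqrt (f ((Pi.single ⟨0, hs⟩ y : Fin s → ℝ≥0) j))
      = NNReal.sqrt (f y) := by
    rw [Finset.sum_eq_single ⟨0, hs⟩]
    · simp
    · intro b _ hb
      simp [Pi.single_eq_of_ne hb, h.map_zero]
    · simp
  rw [h2, Finset.sum_pi_single', if_pos (Finset.mem_univ _), NNReal.sq_sqrt] at h1
  have hs0 : (0 : ℝ≥0) < s := by exact_mod_cast hs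
  have h3 : 1 ≤ cf f s / s := by
    by_contra hc
    push Not at hc
    exact absurd h1 (not_le.mpr (mul_lt_of_lt_one_left (pos_iff_ne_zero.mpr hy) hc))
  rwa [le_div_iff₀ hs0, one_mul] at h3

end ApproxInvertible

/-! ### Inverse transform sampling and Chernoff's bound. -/

/-- The uniform distribution on `[0, 1)`. -/
noncomputable def uniformUnit : Measure ℝ := volume.restrict (Set.Ico 0 1)

instance : IsProbabilityMeasure uniformUnit := ⟨by simp [uniformUnit]⟩

/-- Inverse transform sampling from a subprobability vector. -/
lemma exists_sampler {n : ℕ} (q : Fin n → ℝ) (hq : ∀ i, 0 ≤ q i) (hq1 : ∑ i, q i ≤ 1) :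
    ∃ σ : ℝ → Option (Fin n), ∀ i, MeasurableSet {v | σ v = some i} ∧
      uniformUnit.real {v | σ v = some i} = q i := by
  classical
  set S : Fin n → ℝ := fun i => ∑ l ∈ Finset.Iio i, q l with hS
  have hS0 : ∀ i, 0 ≤ S i := fun i => Finset.sum_nonneg fun l _ => hq l
  have hSq : ∀ i, S i + q i = ∑ l ∈ Finset.Iic i, q l := by
    intro i
    rw [← Finset.Iio_insert, Finset.sum_insert (by simp)]
    exact add_comm _ _
  have hlt : ∀ i i', i < i' → S i + q i ≤ S i' := by
    intro i i' hi
    rw [hSq]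
    refine Finset.sum_le_sum_of_subset_of_nonneg ?_ fun l _ _ => hq l
    intro l hl
    simp only [Finset.mem_Iic, Finset.mem_Iio] at hl ⊢
    exact lt_of_le_of_lt hl hi
  have hle1 : ∀ i, S i + q i ≤ 1 := by
    intro i
    rw [hSq]
    exact (Finset.sum_le_sum_of_subset_of_nonneg (Finset.subset_univ _) fun l _ _ => hq l).trans hq1
  have huniq : ∀ v i i', v ∈ Set.Ico (S i) (S i + q i) → v ∈ Set.Ico (S i') (S i' + q i') →
      i = i' := by
    intro v i i' h h'
    rcases lt_trichotomy i i' with hl | hl | hl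
    · exact absurd (h.2.trans_le ((hlt _ _ hl).trans h'.1)) (lt_irrefl _)
    · exact hl
    · exact absurd (h'.2.trans_le ((hlt _ _ hl).trans h.1)) (lt_irrefl _)
  -- Consecutive intervals of lengths q i; the mass left over in [0, 1) yields `none`.
  refine ⟨fun v => if h : ∃ i, v ∈ Set.Ico (S i) (S i + q i) then some h.choose else none,
    fun i => ?_⟩
  have hset : {v | (if h : ∃ i, v ∈ Set.Ico (S i) (S i + q i) then some h.choose else none)
      = some i} = Set.Ico (S i) (S i + q i) := by
    ext v
    simp only [Set.mem_ofPred_eq]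
    constructor
    · intro h
      split_ifs at h with hv
      have := hv.choose_spec
      rw [Option.some.injEq] at h
      rwa [h] at this
    · intro h
      have hv : ∃ i, v ∈ Set.Ico (S i) (S i + q i) := ⟨i, h⟩
      rw [dif_pos hv, Option.some.injEq]
      exact huniq v _ _ hv.choose_spec h
  rw [hset]
  refine ⟨measurableSet_Ico, ?_⟩
  rw [uniformUnit, measureReal_restrict_apply measurableSet_Ico, Set.inter_eq_left.mpr]
  · simp [hq i]
  · exact Set.Ico_subset_Ico (hS0 i) (hle1 i)

section Chernoff

variable {ι Y : Type*} [Fintype ι] [MeasurableSpace Y] (ν : Measure Y) [IsProbabilityMeasure ν]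

/-- By convexity the exponential lies below its chord on [0, c]; then 1 + t ≤ exp t. -/
lemma integral_exp_mul_le (c : ℝ) {Z : Y → ℝ} (hZ : Measurable Z) (h0 : ∀ v, 0 ≤ Z v)
    (h1 : ∀ v, Z v ≤ 1) :
    ∫ v, Real.exp (c * Z v) ∂ν ≤ Real.exp ((Real.exp c - 1) * ∫ v, Z v ∂ν) := by
  have hint : Integrable Z ν := Integrable.of_bound hZ.aestronglyMeasurable 1
    (ae_of_all _ fun v => by rw [Real.norm_eq_abs, abs_of_nonneg (h0 v)]; exact h1 v)
  have hpt : ∀ v, Real.exp (c * Z v) ≤ 1 + (Real.exp c - 1) * Z v := by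
    intro v
    have := convexOn_exp.2 (Set.mem_univ 0) (Set.mem_univ c) (sub_nonneg.mpr (h1 v)) (h0 v)
      (by ring)
    simp only [smul_eq_mul, mul_zero, zero_add, Real.exp_zero, mul_one] at this
    rw [mul_comm c]
    linarith
  calc ∫ v, Real.exp (c * Z v) ∂ν ≤ ∫ v, (1 + (Real.exp c - 1) * Z v) ∂ν := by
        refine integral_mono_of_nonneg (ae_of_all _ fun v => (Real.exp_pos _).le) ?_
          (ae_of_all _ hpt)
        exact (integrable_const _).add (hint.const_mul _)
    _ = 1 + (Real.exp c - 1) * ∫ v, Z v ∂ν := by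
        rw [integral_add (integrable_const _) (hint.const_mul _), integral_const_mul]
        simp
    _ ≤ _ := by rw [add_comm]; exact Real.add_one_le_exp _

/-- Chernoff's bound for sums of independent variables with values in `[0, 1]`; upper tails are
`0 < c`, lower tails are `c < 0`. -/
lemma chernoff (c t : ℝ) {Z : ι → Y → ℝ} (hZ : ∀ i, Measurable (Z i)) (h0 : ∀ i v, 0 ≤ Z i v)
    (h1 : ∀ i v, Z i v ≤ 1) :
    (Measure.pi fun _ : ι => ν).real {v | t ≤ c * ∑ i, Z i (v i)} ≤
      Real.exp (-t + (Real.exp c - 1) * ∑ i, ∫ v, Z i v ∂ν) := by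
  set P := Measure.pi fun _ : ι => ν
  have hmeas : Measurable fun v : ι → Y => Real.exp (c * ∑ i, Z i (v i)) := by
    refine Real.measurable_exp.comp (Measurable.const_mul ?_ _)
    exact Finset.measurable_sum _ fun i _ => (hZ i).comp (measurable_pi_apply i)
  have hbd : ∀ v : ι → Y, Real.exp (c * ∑ i, Z i (v i)) ≤ Real.exp (|c| * Fintype.card ι) := by
    intro v
    apply Real.exp_le_exp.mpr
    have hs0 : 0 ≤ ∑ i, Z i (v i) := Finset.sum_nonneg fun i _ => h0 i _
    have hs1 : ∑ i, Z i (v i) ≤ Fintype.card ι := by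
      calc ∑ i, Z i (v i) ≤ ∑ _i : ι, (1 : ℝ) := Finset.sum_le_sum fun i _ => h1 i _
        _ = _ := by simp
    calc c * ∑ i, Z i (v i) ≤ |c| * ∑ i, Z i (v i) := by gcongr; exact le_abs_self c
      _ ≤ _ := by gcongr
  have hint : Integrable (fun v : ι → Y => Real.exp (c * ∑ i, Z i (v i))) P :=
    Integrable.of_bound hmeas.aestronglyMeasurable (Real.exp (|c| * Fintype.card ι))
      (ae_of_all _ fun v => by rw [Real.norm_eq_abs, abs_of_pos (Real.exp_pos _)]; exact hbd v)
  have hmk := mul_meas_ge_le_integral_of_nonneg (μ := P)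
    (ae_of_all _ fun v => (Real.exp_pos _).le) hint (Real.exp t)
  have hset : {v : ι → Y | Real.exp t ≤ Real.exp (c * ∑ i, Z i (v i))}
      = {v | t ≤ c * ∑ i, Z i (v i)} := by
    ext v; simp
  rw [hset] at hmk
  have hprod : ∫ v, Real.exp (c * ∑ i, Z i (v i)) ∂P = ∏ i, ∫ v, Real.exp (c * Z i v) ∂ν := by
    rw [← integral_fintype_prod_eq_prod (𝕜 := ℝ) (fun i v => Real.exp (c * Z i v))]
    congr 1
    ext v
    rw [Finset.mul_sum, Real.exp_sum]
  have hle : ∏ i, ∫ v, Real.exp (c * Z i v) ∂ν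
      ≤ Real.exp ((Real.exp c - 1) * ∑ i, ∫ v, Z i v ∂ν) := by
    rw [Finset.mul_sum, Real.exp_sum]
    exact Finset.prod_le_prod (fun i _ => integral_nonneg fun v => (Real.exp_pos _).le)
      fun i _ => integral_exp_mul_le ν c (hZ i) (h0 i) (h1 i)
  rw [hprod] at hmk
  rw [Real.exp_add, Real.exp_neg, inv_mul_eq_div, le_div_iff₀ (Real.exp_pos t), mul_comm]
  exact hmk.trans hle

end Chernoff

/-! ### Tails of clipped Horvitz–Thompson sums. -/

open Classical in
lemma integral_scaled_hit {Y : Type*} [MeasurableSpace Y] (ν : Measure Y) {A : Set Y} (hA : MeasurableSet A) (r : ℝ) :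
    ∫ v, (if v ∈ A then r else 0) ∂ν = ν.real A * r := by
  have : (fun v => if v ∈ A then r else 0) = A.indicator fun _ => r := by
    ext v; simp [Set.indicator]
  rw [this, integral_indicator_const r hA, smul_eq_mul]

section Estimator

variable {s N : ℕ} {Y : Type*} [MeasurableSpace Y] (ν : Measure Y) [IsProbabilityMeasure ν]

open Classical in
/-- The clipped Horvitz–Thompson sum: every hit of server `j` contributes `z j`, clipped at `b`. -/
noncomputable def clippedSum (A : Fin s → Set Y) (z : Fin s → ℝ) (b : ℝ)
    (v : Fin s × Fin N → Y) : ℝ :=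
  ∑ p : Fin s × Fin N, if v p ∈ A p.1 then min (z p.1) b else 0

open Classical in
lemma clippedSum_tail (A : Fin s → Set Y) (hA : ∀ j, MeasurableSet (A j)) {z : Fin s → ℝ}
    (hz : ∀ j, 0 ≤ z j) {b : ℝ} (hb : 0 < b) (c t : ℝ) :
    (Measure.pi fun _ : Fin s × Fin N => ν).real {v | t ≤ c * (clippedSum A z b v / b)} ≤
      Real.exp (-t + (Real.exp c - 1) * ((∑ j, N * ν.real (A j) * min (z j) b) / b)) := by
  have h := chernoff (ι := Fin s × Fin N) ν c t
    (Z := fun p v => if v ∈ A p.1 then min (z p.1) b / b else 0)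
    (fun p => Measurable.ite (hA p.1) measurable_const measurable_const)
    (fun p v => by
      split_ifs
      · exact div_nonneg (le_min (hz _) hb.le) hb.le
      · exact le_rfl)
    (fun p v => by
      split_ifs
      · exact (div_le_one hb).mpr (min_le_right _ _)
      · exact zero_le_one)
  have e1 : ∀ v : Fin s × Fin N → Y, ∑ p, (if v p ∈ A p.1 then min (z p.1) b / b else 0)
      = clippedSum A z b v / b := by
    intro v
    rw [clippedSum, Finset.sum_div]
    refine Finset.sum_congr rfl fun p _ => ?_
    split_ifs <;> simp
  have e2 : ∑ p : Fin s × Fin N, ∫ v, (if v ∈ A p.1 then min (z p.1) b / b else 0) ∂ν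
      = (∑ j, N * ν.real (A j) * min (z j) b) / b := by
    rw [Fintype.sum_prod_type, Finset.sum_div]
    refine Finset.sum_congr rfl fun j _ => ?_
    simp only [integral_scaled_hit ν (hA j)]
    rw [Finset.sum_const, Finset.card_univ, Fintype.card_fin, nsmul_eq_mul]
    ring
  simp only [e1, e2] at h
  exact h

/-- In units of the clip y/L the summands lie in [0, 1], the mean is at most L/4 and the event asks
for L. Chernoff with c = 1 and e − 1 ≤ 2 gives the exponent −L + L/2. -/
lemma clippedSum_upper (A : Fin s → Set Y) (hA : ∀ j, MeasurableSet (A j)) {x : Fin s → ℝ}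
    (hx : ∀ j, 0 ≤ x j) {L y : ℝ} (hL : 0 < L) (hy : 0 < y) (hxy : 4 * ∑ j, x j ≤ y) :
    (Measure.pi fun _ : Fin s × Fin N => ν).real
      {v | y ≤ clippedSum A (fun j => x j / (N * ν.real (A j))) (y / L) v} ≤
      Real.exp (-(L / 2)) := by
  set z : Fin s → ℝ := fun j => x j / (N * ν.real (A j)) with hz
  have hz0 : ∀ j, 0 ≤ z j := fun j => div_nonneg (hx j) (by positivity)
  have hb : 0 < y / L := by positivity
  have h := clippedSum_tail (N := N) ν A hA hz0 hb 1 L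
  have hset : {v : Fin s × Fin N → Y | y ≤ clippedSum A z (y / L) v}
      = {v | L ≤ 1 * (clippedSum A z (y / L) v / (y / L))} := by
    ext v
    simp only [Set.mem_ofPred_eq, one_mul]
    rw [le_div_iff₀ hb, mul_div_cancel₀ _ hL.ne']
  rw [hset]
  refine h.trans (Real.exp_le_exp.mpr ?_)
  have hm : (∑ j, N * ν.real (A j) * min (z j) (y / L)) / (y / L) ≤ L / 4 := by
    rw [div_le_iff₀ hb]
    calc ∑ j, N * ν.real (A j) * min (z j) (y / L) ≤ ∑ j, x j := by
          refine Finset.sum_le_sum fun j _ => ?_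
          calc N * ν.real (A j) * min (z j) (y / L) ≤ N * ν.real (A j) * z j := by
                gcongr; exact min_le_left _ _
            _ ≤ x j := by
                rw [hz]
                rcases eq_or_ne ((N : ℝ) * ν.real (A j)) 0 with h0 | h0
                · simp [h0, hx j]
                · rw [mul_div_cancel₀ _ h0]
      _ ≤ y / 4 := by linarith
      _ = L / 4 * (y / L) := by field_simp
  have he : Real.exp 1 - 1 ≤ 2 := by have := Real.exp_one_lt_d9; linarith
  have he0 : 0 ≤ Real.exp 1 - 1 := by have := Real.exp_one_gt_d9; linarith
  have : (Real.exp 1 - 1) * ((∑ j, N * ν.real (A j) * min (z j) (y / L)) / (y / L))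
      ≤ 2 * (L / 4) := mul_le_mul he hm
        (div_nonneg (Finset.sum_nonneg fun j _ => mul_nonneg (by positivity)
          (le_min (hz0 j) hb.le)) hb.le) (by norm_num)
  linarith

/-- For servers in G the clip is inactive, so in units of y/L the mean is at least 4L, while the
event asks for less than L. Chernoff with c = −1 applies. -/
lemma clippedSum_lower (A : Fin s → Set Y) (hA : ∀ j, MeasurableSet (A j)) {x : Fin s → ℝ}
    (hx : ∀ j, 0 ≤ x j) {L y : ℝ} (hL : 0 < L) (hy : 0 < y) (G : Finset (Fin s))
    (hG : ∀ j ∈ G, L * x j ≤ y * (N * ν.real (A j))) (hxy : 4 * y ≤ ∑ j ∈ G, x j) :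
    (Measure.pi fun _ : Fin s × Fin N => ν).real
      {v | ¬ y ≤ clippedSum A (fun j => x j / (N * ν.real (A j))) (y / L) v} ≤
      Real.exp (-(L / 2)) := by
  set z : Fin s → ℝ := fun j => x j / (N * ν.real (A j)) with hz
  have hz0 : ∀ j, 0 ≤ z j := fun j => div_nonneg (hx j) (by positivity)
  have hb : 0 < y / L := by positivity
  have h := clippedSum_tail (N := N) ν A hA hz0 hb (-1) (-L)
  have hset : {v : Fin s × Fin N → Y | ¬ y ≤ clippedSum A z (y / L) v}
      ⊆ {v | -L ≤ -1 * (clippedSum A z (y / L) v / (y / L))} := by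
    intro v hv
    simp only [Set.mem_ofPred_eq, not_le] at hv ⊢
    have : clippedSum A z (y / L) v / (y / L) ≤ L := by
      rw [div_le_iff₀ hb, mul_div_cancel₀ _ hL.ne']
      exact hv.le
    linarith
  refine (measureReal_mono hset).trans (h.trans (Real.exp_le_exp.mpr ?_))
  have hm : 4 * L ≤ (∑ j, N * ν.real (A j) * min (z j) (y / L)) / (y / L) := by
    rw [le_div_iff₀ hb]
    calc 4 * L * (y / L) = 4 * y := by field_simp
      _ ≤ ∑ j ∈ G, x j := hxy
      _ ≤ ∑ j ∈ G, N * ν.real (A j) * min (z j) (y / L) := by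
          refine Finset.sum_le_sum fun j hj => ?_
          have hj' := hG j hj
          have hq0 : 0 ≤ (N : ℝ) * ν.real (A j) := by positivity
          -- A server in G that never hits must hold x j = 0, so nothing is lost.
          rcases eq_or_ne ((N : ℝ) * ν.real (A j)) 0 with h0 | h0
          · rw [h0, mul_zero] at hj'
            rw [h0, zero_mul]
            exact nonpos_of_mul_nonpos_right hj' hL
          · have hq : 0 < (N : ℝ) * ν.real (A j) := lt_of_le_of_ne hq0 h0.symm
            have : min (z j) (y / L) = z j := by
              apply min_eq_left
              rw [hz]
              rw [div_le_div_iff₀ hq hL]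
              linarith
            rw [this, hz, mul_div_cancel₀ _ h0]
      _ ≤ _ := Finset.sum_le_sum_of_subset_of_nonneg (Finset.subset_univ _) fun j _ _ =>
          mul_nonneg (by positivity) (le_min (hz0 j) hb.le)
  have he : Real.exp (-1) ≤ 1 / 2 := by
    rw [Real.exp_neg, one_div]
    apply inv_anti₀ (by norm_num)
    have := Real.exp_one_gt_d9; linarith
  nlinarith [Real.exp_pos (-1)]

end Estimator

/-! ### Threshold sampling for a fixed choice of ranks. -/

section Threshold

variable {n : ℕ}

/-- The reciprocal `n / (u i + 1)` of the rank of coordinate `i`. -/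
noncomputable def rankWeight (u : Fin n → Fin n) (i : Fin n) : ℝ := n / ((u i : ℝ) + 1)

/-- The probability that a coordinate of value `a` has priority at least `τ`. -/
noncomputable def inclusionProb (n : ℕ) (a τ : ℝ) : ℝ := (min n ⌊a * n / τ⌋₊ : ℕ) / n

open Classical in
/-- The Horvitz–Thompson estimator of `∑ i, a i` with threshold `τ`. -/
noncomputable def thresholdEstimate (a : Fin n → ℝ) (u : Fin n → Fin n) (τ : ℝ) : ℝ :=
  ∑ i, if τ ≤ a i * rankWeight u i then a i / inclusionProb n (a i) τ else 0

open Classical in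
/-- A proxy for the size of the threshold sample, antitone in the threshold. -/
noncomputable def thresholdSize (a : Fin n → ℝ) (u : Fin n → Fin n) (τ : ℝ) : ℝ :=
  ∑ i, if τ ≤ a i * rankWeight u i then max (a i / τ) 1 else 0

open Classical in
/-- The estimator with the dyadic threshold at which the sample size crosses `K`. -/
noncomputable def crossingEstimate (K : ℝ) (a : Fin n → ℝ) (u : Fin n → Fin n) : ℝ :=
  if h : ∃ k : ℤ, K ≤ thresholdSize a u (2 ^ k) ∧ ¬ K ≤ thresholdSize a u (2 ^ (k + 1))
  then thresholdEstimate a u (2 ^ h.choose) else 0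

lemma rankWeight_nonneg (u : Fin n → Fin n) (i : Fin n) : 0 ≤ rankWeight u i := by
  unfold rankWeight; positivity

lemma inclusionProb_nonneg (a τ : ℝ) : 0 ≤ inclusionProb n a τ := by
  unfold inclusionProb; positivity

lemma inclusionProb_le_one (a τ : ℝ) : inclusionProb n a τ ≤ 1 := by
  unfold inclusionProb
  apply div_le_one_of_le₀ _ (by positivity)
  exact_mod_cast min_le_left _ _

lemma inclusionProb_le {a τ : ℝ} (ha : 0 ≤ a) (hτ : 0 < τ) : inclusionProb n a τ ≤ a / τ := by
  unfold inclusionProb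
  rcases Nat.eq_zero_or_pos n with rfl | hn
  · simp; positivity
  have hn' : (0 : ℝ) < n := by exact_mod_cast hn
  rw [div_le_iff₀ hn']
  calc ((min n ⌊a * n / τ⌋₊ : ℕ) : ℝ) ≤ ⌊a * n / τ⌋₊ := by exact_mod_cast min_le_right _ _
    _ ≤ a * n / τ := Nat.floor_le (by positivity)
    _ = a / τ * n := by ring

/-- A positive inclusion probability is at least half of the ideal one. -/
lemma le_two_mul_inclusionProb {a τ : ℝ} (hτ : 0 < τ)
    (h0 : 0 < inclusionProb n a τ) (h1 : inclusionProb n a τ ≠ 1) :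
    a ≤ 2 * τ * inclusionProb n a τ := by
  unfold inclusionProb at *
  rcases Nat.eq_zero_or_pos n with rfl | hn
  · simp at h0
  have hn' : (0 : ℝ) < n := by exact_mod_cast hn
  have hlt : ⌊a * n / τ⌋₊ < n := by
    by_contra hc
    push Not at hc
    rw [min_eq_left hc] at h1
    exact h1 (div_self hn'.ne')
  rw [min_eq_right hlt.le] at *
  have hfl : 1 ≤ ⌊a * n / τ⌋₊ := by
    by_contra hc
    push Not at hc
    have : ⌊a * n / τ⌋₊ = 0 := by omega
    simp [this] at h0
  have h2 := Nat.lt_floor_add_one (a * n / τ)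
  have h3 : (1 : ℝ) ≤ ⌊a * n / τ⌋₊ := by exact_mod_cast hfl
  have h4 : a * n / τ ≤ 2 * ⌊a * n / τ⌋₊ := by linarith
  rw [div_le_iff₀ hτ] at h4
  rw [mul_div_assoc', le_div_iff₀ hn']
  linarith

/-- Ranks are counted from 0, so exactly the first min(n, ⌊an/τ⌋) ranks lead to inclusion; this is
the numerator of `inclusionProb`. -/
lemma le_rank_iff {a τ : ℝ} (hτ : 0 < τ) (m : Fin n) :
    τ ≤ a * (n / ((m : ℝ) + 1)) ↔ (m : ℕ) < min n ⌊a * n / τ⌋₊ := by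
  rw [lt_min_iff]
  simp only [m.isLt, true_and]
  rw [← Nat.succ_le_iff, Nat.le_floor_iff' (Nat.succ_ne_zero _), le_div_iff₀ hτ, mul_div_assoc',
    le_div_iff₀ (by positivity)]
  push_cast
  rw [mul_comm τ]

lemma inclusionProb_pos_of_le {a τ : ℝ} (hτ : 0 < τ) {m : Fin n}
    (h : τ ≤ a * (n / ((m : ℝ) + 1))) : 0 < inclusionProb n a τ := by
  have := (le_rank_iff hτ m).mp h
  unfold inclusionProb
  have h1 : 0 < min n ⌊a * n / τ⌋₊ := lt_of_le_of_lt (Nat.zero_le _) this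
  have hn : 0 < n := m.pos
  exact div_pos (by exact_mod_cast h1) (by exact_mod_cast hn)

open Classical in
lemma sum_indicator_rank {a τ : ℝ} (hτ : 0 < τ) (r : ℝ) :
    (∑ m : Fin n, if τ ≤ a * (n / ((m : ℝ) + 1)) then r else 0) / n
      = inclusionProb n a τ * r := by
  simp only [le_rank_iff hτ]
  rw [← Finset.sum_filter, Finset.sum_const, Fin.card_filter_val_lt, nsmul_eq_mul, inclusionProb,
    ← min_assoc, min_self]
  ring

lemma thresholdSize_antitone {a : Fin n → ℝ} (ha : ∀ i, 0 ≤ a i) (u : Fin n → Fin n) {τ τ' : ℝ}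
    (hτ : 0 < τ) (h : τ ≤ τ') : thresholdSize a u τ' ≤ thresholdSize a u τ := by
  unfold thresholdSize
  refine Finset.sum_le_sum fun i _ => ?_
  have := ha i
  by_cases h1 : τ' ≤ a i * rankWeight u i
  · rw [if_pos h1, if_pos (h.trans h1)]
    gcongr
  · rw [if_neg h1]
    split_ifs <;> positivity

/-- This explains the summand max(a/τ, 1) of the size: a/τ covers coordinates included with
certainty, and 1 covers the others, whose contribution is at most 2τ. -/
lemma thresholdEstimate_le {a : Fin n → ℝ} (ha : ∀ i, 0 ≤ a i) (u : Fin n → Fin n) {τ : ℝ}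
    (hτ : 0 < τ) : thresholdEstimate a u τ ≤ 2 * τ * thresholdSize a u τ := by
  unfold thresholdSize thresholdEstimate
  rw [Finset.mul_sum]
  refine Finset.sum_le_sum fun i _ => ?_
  split_ifs with h
  · have hpos := inclusionProb_pos_of_le hτ h
    by_cases h1 : inclusionProb n (a i) τ = 1
    · rw [h1, div_one]
      calc a i ≤ 2 * a i := by linarith [ha i]
        _ = 2 * τ * (a i / τ) := by field_simp
        _ ≤ _ := by gcongr; exact le_max_left _ _
    · rw [div_le_iff₀ hpos]
      calc a i ≤ 2 * τ * inclusionProb n (a i) τ := le_two_mul_inclusionProb hτ hpos h1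
        _ = 2 * τ * 1 * inclusionProb n (a i) τ := by ring
        _ ≤ _ := by gcongr; exact le_max_right _ _
  · simp

/-- Changing coordinates of low priority does not affect the crossing estimate. -/
lemma crossingEstimate_eq {K : ℝ} {a : Fin n → ℝ} (ha : ∀ i, 0 ≤ a i) (u : Fin n → Fin n)
    {k₀ k₁ : ℤ} (h0 : K ≤ thresholdSize a u (2 ^ k₀)) (h1 : ¬ K ≤ thresholdSize a u (2 ^ k₁))
    {a' : Fin n → ℝ} (h' : ∀ i, a' i = a i ∨ (a' i = 0 ∧ a i * rankWeight u i < 2 ^ k₀)) :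
    ∃ k, k₀ ≤ k ∧ k < k₁ ∧ crossingEstimate K a' u = thresholdEstimate a u (2 ^ k) := by
  have ha' : ∀ i, 0 ≤ a' i := fun i => by
    rcases h' i with h | h
    · rw [h]; exact ha i
    · rw [h.1]
  have hp : ∀ k : ℤ, (0 : ℝ) < 2 ^ k := fun k => by positivity
  have hmono : ∀ {k k' : ℤ}, k ≤ k' → (2 : ℝ) ^ k ≤ 2 ^ k' := fun h =>
    zpow_le_zpow_right₀ (by norm_num) h
  have hsize : ∀ k, k₀ ≤ k → thresholdSize a' u (2 ^ k) = thresholdSize a u (2 ^ k) := by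
    -- The coordinates set to 0 had priority below 2^k₀ ≤ 2^k and were not counted anyway.
    intro k hk
    refine Finset.sum_congr rfl fun i _ => ?_
    rcases h' i with h | h
    · rw [h]
    · rw [if_neg, if_neg]
      · exact not_le.mpr (h.2.trans_le (hmono hk))
      · rw [h.1, zero_mul]; exact not_le.mpr (hp k)
  have hest : ∀ k, k₀ ≤ k → thresholdEstimate a' u (2 ^ k) = thresholdEstimate a u (2 ^ k) := by
    intro k hk
    refine Finset.sum_congr rfl fun i _ => ?_
    rcases h' i with h | h
    · rw [h]
    · rw [if_neg, if_neg]
      · exact not_le.mpr (h.2.trans_le (hmono hk))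
      · rw [h.1, zero_mul]; exact not_le.mpr (hp k)
  have hlow : ∀ k, k ≤ k₀ → K ≤ thresholdSize a' u (2 ^ k) := fun k hk =>
    (h0.trans_eq (hsize k₀ le_rfl).symm).trans (thresholdSize_antitone ha' u (hp k) (hmono hk))
  have hk01 : k₀ < k₁ := by
    by_contra hc
    push Not at hc
    exact h1 (h0.trans (thresholdSize_antitone ha u (hp _) (hmono hc)))
  have hhigh : ∀ k, k₁ ≤ k → ¬ K ≤ thresholdSize a' u (2 ^ k) := by
    intro k hk hc
    rw [hsize k (hk01.le.trans hk)] at hc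
    exact h1 (hc.trans (thresholdSize_antitone ha u (hp _) (hmono hk)))
  -- Without a crossing, the size would stay at least K from k₀ upwards and so beyond k₁.
  have hex : ∃ k : ℤ, K ≤ thresholdSize a' u (2 ^ k) ∧
      ¬ K ≤ thresholdSize a' u (2 ^ (k + 1)) := by
    by_contra hc
    push Not at hc
    have : ∀ m : ℕ, K ≤ thresholdSize a' u (2 ^ (k₀ + m)) := by
      intro m
      induction m with
      | zero => simpa using hlow k₀ le_rfl
      | succ m ih =>
        have := hc _ ih
        rwa [Nat.cast_succ, ← add_assoc]
    refine hhigh (k₀ + (k₁ - k₀).toNat) ?_ (this _)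
    omega
  rw [crossingEstimate, dif_pos hex]
  have hspec := hex.choose_spec
  generalize hex.choose = k at hspec ⊢
  have hk : k₀ ≤ k := by
    by_contra hc
    push Not at hc
    exact hspec.2 (hlow _ hc)
  refine ⟨k, hk, ?_, hest k hk⟩
  by_contra hc
  push Not at hc
  exact hhigh _ hc hspec.1

end Threshold

/-! ### Threshold sampling with random ranks. -/

section RandomRanks

variable (n : ℕ) [NeZero n]

/-- Independent uniform ranks. -/
noncomputable def rankMeasure : Measure (Fin n → Fin n) :=
  Measure.pi fun _ => (PMF.uniformOfFintype (Fin n)).toMeasure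

instance : IsProbabilityMeasure (rankMeasure n) := by unfold rankMeasure; infer_instance

variable {n}

lemma integral_rank (φ : Fin n → ℝ) :
    ∫ m, φ m ∂(PMF.uniformOfFintype (Fin n)).toMeasure = (∑ m, φ m) / n := by
  rw [PMF.integral_eq_sum]
  simp [div_eq_inv_mul, Finset.mul_sum]

lemma integral_eval_rank (i : Fin n) (φ : Fin n → ℝ) :
    ∫ u, φ (u i) ∂rankMeasure n = (∑ m, φ m) / n := by
  rw [← integral_rank, rankMeasure]
  exact integral_comp_eval (μ := fun _ : Fin n => (PMF.uniformOfFintype (Fin n)).toMeasure)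
    (f := φ) (i := i) Measurable.of_discrete.aestronglyMeasurable

/-- The mean is the n-th harmonic number. -/
lemma integral_rankWeight_le (i : Fin n) :
    ∫ u, rankWeight u i ∂rankMeasure n ≤ 1 + Real.log n := by
  unfold rankWeight
  rw [integral_eval_rank i (fun m => (n : ℝ) / ((m : ℝ) + 1))]
  have hn : (n : ℝ) ≠ 0 := by exact_mod_cast NeZero.ne n
  refine le_trans (le_of_eq ?_) (harmonic_le_one_add_log n)
  rw [harmonic, Finset.sum_div, Finset.sum_range]
  push_cast
  refine Finset.sum_congr rfl fun m _ => ?_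
  field_simp

lemma integrable_rank (φ : (Fin n → Fin n) → ℝ) : Integrable φ (rankMeasure n) :=
  Integrable.of_finite

lemma measure_weight_le {a : Fin n → ℝ} (ha : ∀ i, 0 ≤ a i) (hF : 0 < ∑ i, a i) :
    (rankMeasure n).real {u | 50 * ((∑ i, a i) * (1 + Real.log n)) ≤ ∑ i, a i * rankWeight u i}
      ≤ 1 / 50 := by
  have hlog : 0 ≤ Real.log n := Real.log_natCast_nonneg n
  have h := mul_meas_ge_le_integral_of_nonneg (μ := rankMeasure n)
    (f := fun u => ∑ i, a i * rankWeight u i)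
    (ae_of_all _ fun u => Finset.sum_nonneg fun i _ => mul_nonneg (ha i) (rankWeight_nonneg u i))
    (integrable_rank _) (50 * ((∑ i, a i) * (1 + Real.log n)))
  have h2 : ∫ u, ∑ i, a i * rankWeight u i ∂rankMeasure n ≤ (∑ i, a i) * (1 + Real.log n) := by
    rw [integral_finsetSum _ fun i _ => integrable_rank _, Finset.sum_mul]
    refine Finset.sum_le_sum fun i _ => ?_
    rw [integral_const_mul]
    exact mul_le_mul_of_nonneg_left (integral_rankWeight_le i) (ha i)
  have hpos : 0 < (∑ i, a i) * (1 + Real.log n) := by positivity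
  have h3 := h.trans h2
  rw [le_div_iff₀ (by norm_num)]
  by_contra hc
  push Not at hc
  nlinarith

/-- Markov's inequality: a coordinate is included with probability at most min(1, a/τ), so its
counted size has mean at most a/τ whichever term of the maximum applies. -/
lemma measure_thresholdSize_le {a : Fin n → ℝ} (ha : ∀ i, 0 ≤ a i) {τ : ℝ} (hτ : 0 < τ)
    {K : ℝ} (hK : 0 < K) (h : 50 * ∑ i, a i ≤ K * τ) :
    (rankMeasure n).real {u | K ≤ thresholdSize a u τ} ≤ 1 / 50 := by
  have h1 := mul_meas_ge_le_integral_of_nonneg (μ := rankMeasure n)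
    (f := fun u => thresholdSize a u τ)
    (ae_of_all _ fun u => Finset.sum_nonneg fun i _ => by split_ifs <;> positivity)
    (integrable_rank _) K
  have h2 : ∫ u, thresholdSize a u τ ∂rankMeasure n ≤ (∑ i, a i) / τ := by
    unfold thresholdSize rankWeight
    rw [integral_finsetSum _ fun i _ => integrable_rank _, Finset.sum_div]
    refine Finset.sum_le_sum fun i _ => ?_
    rw [integral_eval_rank i
      (fun m => if τ ≤ a i * (n / ((m : ℝ) + 1)) then max (a i / τ) 1 else 0),
      sum_indicator_rank hτ]
    have hi := ha i
    rcases le_total (a i / τ) 1 with hle | hle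
    · rw [max_eq_right hle, mul_one]
      exact inclusionProb_le hi hτ
    · rw [max_eq_left hle]
      exact mul_le_of_le_one_left (by positivity) (inclusionProb_le_one _ _)
  have h3 := h1.trans h2
  rw [le_div_iff₀ hτ] at h3
  rw [le_div_iff₀ (by norm_num)]
  by_contra hc
  push Not at hc
  nlinarith [mul_pos hK hτ]

open Classical in
-- Coordinates included with probability 0 or 1 have no variance; otherwise the second moment is
-- a²/p, and a/p ≤ 2τ.
lemma variance_thresholdEstimate_le {a : Fin n → ℝ} (ha : ∀ i, 0 ≤ a i) {τ : ℝ} (hτ : 0 < τ) :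
    ProbabilityTheory.variance (fun u => thresholdEstimate a u τ) (rankMeasure n) ≤
      2 * τ * ∑ i, a i := by
  have hsum : (fun u => thresholdEstimate a u τ) = ∑ i, fun u : Fin n → Fin n =>
      (fun m : Fin n => if τ ≤ a i * (n / ((m : ℝ) + 1)) then a i / inclusionProb n (a i) τ else 0)
        (u i) := by
    ext u
    simp only [thresholdEstimate, rankWeight, Finset.sum_apply]
    rfl
  rw [hsum, rankMeasure, ProbabilityTheory.variance_sum_pi
    (X := fun i (m : Fin n) => if τ ≤ a i * (n / ((m : ℝ) + 1)) then
      a i / inclusionProb n (a i) τ else 0) (fun i => MemLp.of_discrete), Finset.mul_sum]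
  refine Finset.sum_le_sum fun i _ => ?_
  rw [ProbabilityTheory.variance_eq_sub MemLp.of_discrete]
  have e1 : ((fun m : Fin n => if τ ≤ a i * (n / ((m : ℝ) + 1)) then
      a i / inclusionProb n (a i) τ else 0) ^ 2) = fun m : Fin n =>
      if τ ≤ a i * (n / ((m : ℝ) + 1)) then (a i / inclusionProb n (a i) τ) ^ 2 else 0 := by
    ext m
    simp only [Pi.pow_apply]
    split_ifs <;> simp
  rw [e1, integral_rank, integral_rank, sum_indicator_rank hτ, sum_indicator_rank hτ]
  set p := inclusionProb n (a i) τ with hp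
  have hi := ha i
  rcases (inclusionProb_nonneg (n := n) (a i) τ).eq_or_lt with h0 | h0
  · rw [← hp] at h0
    rw [← h0]; simp; positivity
  by_cases h1 : p = 1
  · rw [h1]; simp; positivity
  · have h2 := le_two_mul_inclusionProb hτ h0 h1
    rw [← hp] at h0 h2
    have : p * (a i / p) ^ 2 ≤ 2 * τ * a i := by
      have : p * (a i / p) ^ 2 = a i * (a i / p) := by field_simp
      rw [this, mul_comm (2 * τ)]
      gcongr
      rwa [div_le_iff₀ h0]
    nlinarith [sq_nonneg (p * (a i / p))]

/-- The bias comes from the coordinates that are never included; each has value below τ/n. -/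
lemma integral_thresholdEstimate {a : Fin n → ℝ} (ha : ∀ i, 0 ≤ a i) {τ : ℝ} (hτ : 0 < τ) :
    ∫ u, thresholdEstimate a u τ ∂rankMeasure n ∈ Set.Icc (∑ i, a i - τ) (∑ i, a i) := by
  classical
  have hn : (0 : ℝ) < n := by exact_mod_cast NeZero.pos n
  have e : ∫ u, thresholdEstimate a u τ ∂rankMeasure n =
      ∑ i, inclusionProb n (a i) τ * (a i / inclusionProb n (a i) τ) := by
    unfold thresholdEstimate rankWeight
    rw [integral_finsetSum _ fun i _ => integrable_rank _]
    refine Finset.sum_congr rfl fun i _ => ?_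
    rw [integral_eval_rank i
      (fun m => if τ ≤ a i * (n / ((m : ℝ) + 1)) then a i / inclusionProb n (a i) τ else 0),
      sum_indicator_rank hτ]
  rw [e]
  constructor
  · have : ∑ i, a i - ∑ _i : Fin n, τ / n ≤
        ∑ i, inclusionProb n (a i) τ * (a i / inclusionProb n (a i) τ) := by
      rw [← Finset.sum_sub_distrib]
      refine Finset.sum_le_sum fun i _ => ?_
      by_cases h0 : inclusionProb n (a i) τ = 0
      · rw [h0, zero_mul, sub_nonpos, le_div_iff₀ hn]
        by_contra hc
        push Not at hc
        -- Inclusion at the best rank 0 would already make the probability positive.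
        have : τ ≤ a i * (n / (((0 : Fin n) : ℕ) + 1 : ℝ)) := by simpa using hc.le
        exact (inclusionProb_pos_of_le hτ this).ne' h0
      · rw [mul_div_cancel₀ _ h0]
        have : 0 ≤ τ / n := by positivity
        linarith
    have e2 : ∑ _i : Fin n, τ / n = τ := by
      rw [Finset.sum_const, Finset.card_univ, Fintype.card_fin, nsmul_eq_mul]
      field_simp
    rwa [e2] at this
  · refine Finset.sum_le_sum fun i _ => ?_
    by_cases h0 : inclusionProb n (a i) τ = 0
    · rw [h0, zero_mul]; exact ha i
    · rw [mul_div_cancel₀ _ h0]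

/-- Chebyshev at distance εF/4, where the bias τ uses up at most another εF/4: 2τF / (εF/4)² =
32τ/(ε²F) ≤ 1/1000. -/
lemma measure_thresholdEstimate_le {a : Fin n → ℝ} (ha : ∀ i, 0 ≤ a i) {τ ε : ℝ} (hτ : 0 < τ)
    (hε : 0 < ε) (hε1 : ε < 1) (hF : 0 < ∑ i, a i) (h : 32000 * τ ≤ ε ^ 2 * ∑ i, a i) :
    (rankMeasure n).real {u | ¬ |thresholdEstimate a u τ - ∑ i, a i| ≤ ε / 2 * ∑ i, a i}
      ≤ 1 / 1000 := by
  set F := ∑ i, a i with hFdef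
  have hc : 0 < ε / 4 * F := by positivity
  have h1 := ProbabilityTheory.meas_ge_le_variance_div_sq (μ := rankMeasure n)
    (X := fun u => thresholdEstimate a u τ) MemLp.of_discrete hc
  have hm := integral_thresholdEstimate ha hτ
  rw [← hFdef] at hm
  have hv := variance_thresholdEstimate_le ha hτ
  rw [← hFdef] at hv
  have hsub : {u : Fin n → Fin n | ¬ |thresholdEstimate a u τ - F| ≤ ε / 2 * F} ⊆
      {u | ε / 4 * F ≤
        |thresholdEstimate a u τ - ∫ u, thresholdEstimate a u τ ∂rankMeasure n|} := by
    intro u hu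
    simp only [Set.mem_ofPred_eq] at hu ⊢
    by_contra hcon
    push Not at hcon
    apply hu
    have hτF : τ ≤ ε / 4 * F := by nlinarith [mul_pos hε hF]
    rw [abs_lt] at hcon
    rw [abs_le]
    constructor <;> nlinarith [hm.1, hm.2, hcon.1, hcon.2]
  refine (measureReal_mono hsub).trans ?_
  refine (ENNReal.toReal_mono ENNReal.ofReal_ne_top h1).trans ?_
  rw [ENNReal.toReal_ofReal (div_nonneg (ProbabilityTheory.variance_nonneg _ _) (sq_nonneg _))]
  rw [div_le_div_iff₀ (by positivity) (by norm_num)]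
  calc ProbabilityTheory.variance (fun u => thresholdEstimate a u τ) (rankMeasure n) * 1000
      ≤ 2 * τ * F * 1000 := by gcongr
    _ ≤ 1 * (ε / 4 * F) ^ 2 := by nlinarith [mul_le_mul_of_nonneg_right h hF.le]

/-- With high probability the total weight is small, and the crossing estimate is accurate,
even when coordinates of low priority are replaced by `0`. -/
lemma exists_good_ranks {a : Fin n → ℝ} (ha : ∀ i, 0 ≤ a i) (hF : 0 < ∑ i, a i) {ε : ℝ}
    (hε : 0 < ε) (hε1 : ε < 1) :
    ∃ τ : ℝ, 0 < τ ∧ ε ^ 2 * ∑ i, a i ≤ 20000000 * τ ∧ ∃ bad : Set (Fin n → Fin n),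
      (rankMeasure n).real bad ≤ 1 / 20 ∧ ∀ u ∉ bad,
        ∑ i, a i * rankWeight u i ≤ 50 * ((∑ i, a i) * (1 + Real.log n)) ∧
        ∀ a' : Fin n → ℝ, (∀ i, a' i = a i ∨ (a' i = 0 ∧ a i * rankWeight u i < τ)) →
          |crossingEstimate (1600000 / ε ^ 2) a' u - ∑ i, a i| ≤ ε / 2 * ∑ i, a i := by
  set F := ∑ i, a i with hFdef
  obtain ⟨k₁, hk₁, hk₁'⟩ := exists_mem_Ico_zpow (x := ε ^ 2 * F / 16000) (y := (2 : ℝ))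
    (by positivity) (by norm_num)
  rw [zpow_add_one₀ (by norm_num)] at hk₁'
  have hp : ∀ k : ℤ, (0 : ℝ) < 2 ^ k := fun k => by positivity
  -- At 2^k₁ the mean size is at most K/50. Nine halvings suffice to push the size above K: an
  -- estimate of at least F/2 forces size at least F/(4·2^k₀) = 128F/2^k₁ ≥ 2048000/ε².
  set k₀ := k₁ - 9 with hk₀
  have hτ0 : (2 : ℝ) ^ k₀ = 2 ^ k₁ / 512 := by
    rw [hk₀, zpow_sub₀ (by norm_num)]; norm_num
  have hε2 : 0 < ε ^ 2 := by positivity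
  set K := 1600000 / ε ^ 2 with hK
  have hKpos : 0 < K := by positivity
  have hKe : K * ε ^ 2 = 1600000 := by rw [hK]; field_simp
  set B1 := {u : Fin n → Fin n | 50 * (F * (1 + Real.log n)) ≤ ∑ i, a i * rankWeight u i}
  set B2 := {u : Fin n → Fin n | K ≤ thresholdSize a u (2 ^ k₁)}
  -- The crossing index lies in [k₀, k₁), so accuracy is needed at nine thresholds only.
  set B3 := ⋃ k ∈ Finset.Ico k₀ k₁,
    {u : Fin n → Fin n | ¬ |thresholdEstimate a u (2 ^ k) - F| ≤ ε / 2 * F}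
  refine ⟨2 ^ k₀, hp _, ?_, B1 ∪ B2 ∪ B3, ?_, ?_⟩
  · rw [hτ0]; linarith
  · have h1 : (rankMeasure n).real B1 ≤ 1 / 50 := measure_weight_le ha hF
    have h2 : (rankMeasure n).real B2 ≤ 1 / 50 := by
      refine measure_thresholdSize_le ha (hp _) hKpos ?_
      rw [← hFdef]
      nlinarith
    have h3 : (rankMeasure n).real B3 ≤ 9 / 1000 := by
      refine (measureReal_biUnion_finset_le _ _).trans ?_
      calc ∑ k ∈ Finset.Ico k₀ k₁, (rankMeasure n).real
            {u : Fin n → Fin n | ¬ |thresholdEstimate a u (2 ^ k) - F| ≤ ε / 2 * F}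
          ≤ ∑ _k ∈ Finset.Ico k₀ k₁, (1 / 1000 : ℝ) := by
            refine Finset.sum_le_sum fun k hk => ?_
            refine measure_thresholdEstimate_le ha (hp k) hε hε1 hF ?_
            have hk2 := (Finset.mem_Ico.mp hk).2
            have : (2 : ℝ) ^ (k + 1) ≤ 2 ^ k₁ := zpow_le_zpow_right₀ (by norm_num) (by omega)
            rw [zpow_add_one₀ (by norm_num)] at this
            rw [← hFdef]
            linarith
        _ = 9 / 1000 := by
            rw [Finset.sum_const, Int.card_Ico, hk₀, sub_sub_cancel]
            simp; norm_num
    calc (rankMeasure n).real (B1 ∪ B2 ∪ B3) ≤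
          (rankMeasure n).real B1 + (rankMeasure n).real B2 + (rankMeasure n).real B3 :=
          (measureReal_union_le _ _).trans (by gcongr; exact measureReal_union_le _ _)
      _ ≤ 1 / 20 := by linarith
  · intro u hu
    simp only [Set.mem_union, not_or] at hu
    obtain ⟨⟨h1, h2⟩, h3⟩ := hu
    have h3' : ∀ k, k₀ ≤ k → k < k₁ → |thresholdEstimate a u (2 ^ k) - F| ≤ ε / 2 * F := by
      intro k hk hk'
      by_contra hc
      exact h3 (Set.mem_biUnion (Finset.mem_coe.mpr (Finset.mem_Ico.mpr ⟨hk, hk'⟩)) hc)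
    refine ⟨(not_le.mp h1).le, fun a' ha' => ?_⟩
    have hsz : K ≤ thresholdSize a u (2 ^ k₀) := by
      have e1 := h3' k₀ le_rfl (by omega)
      have e2 := thresholdEstimate_le ha u (hp k₀)
      rw [abs_le] at e1
      have e3 : F / 2 ≤ 2 * 2 ^ k₀ * thresholdSize a u (2 ^ k₀) := by nlinarith [e1.1]
      by_contra hc
      push Not at hc
      have e4 : 2 * 2 ^ k₀ * thresholdSize a u (2 ^ k₀) < 2 * 2 ^ k₀ * K := by
        have := hp k₀
        gcongr
      have e5 : 2 * 2 ^ k₀ * K ≤ F / 2 := by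
        rw [hτ0]
        nlinarith
      linarith
    obtain ⟨k, hk, hk', he⟩ := crossingEstimate_eq ha u hsz h2 ha'
    rw [he]
    exact h3' k hk hk'

end RandomRanks

/-! ### Encoding of reports and the shape of the protocol. -/

/-- What a server tells the coordinator in the first round: a reference entry, an integer that
describes the total weight in terms of the reference entry, and a list of sampled entries. -/
abbrev Report (n : ℕ) (D : Set ℝ≥0) : Type := (Fin n × D) × Fin n × List (Fin n × D)

namespace Report

variable {n : ℕ} {D : Set ℝ≥0} {W : Type}

/-- Reports as sequences of words. -/
def encode (e : Fin n ↪ W) (e' : D ↪ W) (r : Report n D) : List W :=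
  e r.1.1 :: e' r.1.2 :: e r.2.1 :: r.2.2.flatMap fun p => [e p.1, e' p.2]

lemma length_encode (e : Fin n ↪ W) (e' : D ↪ W) (r : Report n D) :
    (r.encode e e').length = 3 + 2 * r.2.2.length := by
  simp [encode, List.length_flatMap]
  ring

/-- The ranges of e and e' may overlap; a word's position (three header words, then pairs) tells
which embedding to invert. -/
lemma encode_injective (e : Fin n ↪ W) (e' : D ↪ W) :
    Function.Injective (encode e e' : Report n D → List W) := by
  have key : Function.Injective
      fun l : List (Fin n × D) => l.flatMap fun p => [e p.1, e' p.2] := by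
    intro l
    induction l with
    | nil =>
      intro l' h
      cases l' with
      | nil => rfl
      | cons p l' => simp at h
    | cons p l ih =>
      intro l' h
      cases l' with
      | nil => simp at h
      | cons p' l' =>
        simp only [List.flatMap_cons, List.cons_append, List.nil_append, List.cons.injEq,
          EmbeddingLike.apply_eq_iff_eq] at h
        rw [Prod.ext h.1 h.2.1, ih h.2.2]
  rintro ⟨⟨i, d⟩, k, l⟩ ⟨⟨i', d'⟩, k', l'⟩ h
  simp only [encode, List.cons.injEq, EmbeddingLike.apply_eq_iff_eq] at h
  rw [h.1, h.2.1, h.2.2.1, key h.2.2.2]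

end Report

/-- The protocol in which the servers send reports, the coordinator asks for all entries at a
small set of coordinates, and computes its output from the reports and these entries. -/
lemma exists_protocol {s n : ℕ} {D : Set ℝ≥0} [Nonempty D] {W Ω : Type} (hn : 0 < n)
    (e : Fin n ↪ W) (e' : D ↪ W) (N M : ℕ) (rep : Ω → Fin s → (Fin n → D) → Report n D)
    (hrep : ∀ ω j x, (rep ω j x).2.2.length ≤ N)
    (sel : Ω → (Fin s → Report n D) → Finset (Fin n)) (hsel : ∀ ω r, (sel ω r).card ≤ M)
    (out : Ω → (Fin s → Report n D) → (Fin n → ℝ≥0) → ℝ) :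
    ∃ P : TwoRoundProtocol s n D W Ω,
      (∀ ω x, P.words ω x ≤ s * (3 + 2 * N + 2 * M)) ∧
      ∀ ω x, P.result ω x = out ω (fun j => rep ω j (x j)) fun i =>
        if i ∈ sel ω (fun j => rep ω j (x j)) then ∑ j, (x j i : ℝ≥0) else 0 := by
  have : Nonempty (Fin n) := ⟨⟨0, hn⟩⟩
  set dec : List W → Report n D := Function.invFun (Report.encode e e') with hdec
  have hdec' : ∀ r : Report n D, dec (r.encode e e') = r :=
    Function.leftInverse_invFun (Report.encode_injective e e')
  set d1 : W → Fin n := Function.invFun e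
  have hd1 : ∀ i, d1 (e i) = i := Function.leftInverse_invFun e.injective
  set d2 : W → D := Function.invFun e'
  have hd2 : ∀ d, d2 (e' d) = d := Function.leftInverse_invFun e'.injective
  let P : TwoRoundProtocol s n D W Ω :=
    { first := fun ω j x => (rep ω j x).encode e e'
      query := fun ω m _ => (sel ω fun j => dec (m j)).toList.map e
      second := fun ω j x q => q.map fun w => e' (x (d1 w))
      -- Answers come in the order of the queried list, so an entry is found at the position of its
      -- index. The default 0 is never used for a queried coordinate.
      output := fun ω m m' => out ω (fun j => dec (m j)) fun i =>
        if i ∈ sel ω (fun j => dec (m j)) then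
          ∑ j, ((((m' j).map d2)[(sel ω fun j => dec (m j)).toList.idxOf i]?).elim
            (0 : ℝ≥0) fun d => (d : ℝ≥0)) else 0 }
  have hm1 : ∀ ω x, (fun j => dec (P.msg₁ ω x j)) = fun j => rep ω j (x j) := fun ω x =>
    funext fun j => hdec' _
  have hreply : ∀ ω x j, P.reply ω x j = (sel ω fun j => rep ω j (x j)).toList.map e := by
    intro ω x j
    rw [← hm1]
    rfl
  have hm2 : ∀ ω x j, P.msg₂ ω x j =
      (sel ω fun j => rep ω j (x j)).toList.map fun i => e' (x j i) := by
    intro ω x j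
    change (P.reply ω x j).map (fun w => e' (x j (d1 w))) = _
    rw [hreply, List.map_map]
    congr 1
    ext i
    simp [hd1]
  refine ⟨P, fun ω x => ?_, fun ω x => ?_⟩
  · calc P.words ω x ≤ ∑ _j : Fin s, (3 + 2 * N + 2 * M) := by
          refine Finset.sum_le_sum fun j _ => ?_
          rw [hreply, hm2]
          have h1 : (P.msg₁ ω x j).length = 3 + 2 * (rep ω j (x j)).2.2.length :=
            Report.length_encode e e' _
          have h2 := hrep ω j (x j)
          have h3 := hsel ω fun j => rep ω j (x j)
          rw [h1, List.length_map, List.length_map, Finset.length_toList]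
          omega
      _ = s * (3 + 2 * N + 2 * M) := by simp
  · change out ω (fun j => dec (P.msg₁ ω x j)) (fun i =>
        if i ∈ sel ω (fun j => dec (P.msg₁ ω x j)) then
          ∑ j, ((((P.msg₂ ω x j).map d2)[(sel ω fun j => dec (P.msg₁ ω x j)).toList.idxOf i]?).elim
            (0 : ℝ≥0) fun d => (d : ℝ≥0)) else 0) = _
    rw [hm1]
    congr 1
    ext i
    split_ifs with hi
    · congr 1
      refine Finset.sum_congr rfl fun j _ => ?_
      have hmem : i ∈ (sel ω fun j => rep ω j (x j)).toList := Finset.mem_toList.mpr hi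
      rw [hm2, List.map_map, List.getElem?_map, List.getElem?_idxOf hmem]
      simp [hd2]
    · rfl

/-! ### What the servers report and how the coordinator ranks coordinates. -/

section Reports

variable {n s N : ℕ} {D : Set ℝ≥0} (f : ℝ≥0 → ℝ≥0)

/-- The total weight of the reporting server, up to a factor `2`. -/
noncomputable def reportTotal (u : Fin n → Fin n) (r : Report n D) : ℝ :=
  ((r.2.1 : ℝ) + 1) * (f r.1.2 * rankWeight u r.1.1)

/-- The value of a sampled entry divided by its expected number of occurrences. -/
noncomputable def hitValue (N : ℕ) (u : Fin n → Fin n) (r : Report n D) (p : Fin n × D) : ℝ :=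
  ((p.2 : ℝ≥0) : ℝ) / (N * (f p.2 * rankWeight u p.1 / reportTotal f u r))

/-- The estimate for the entry `i` of the sum vector: the largest `y` which is at most the sum of
the hit values clipped at `y / L`. -/
noncomputable def entryEstimate (N : ℕ) (L : ℝ) (u : Fin n → Fin n) (r : Fin s → Report n D)
    (i : Fin n) : ℝ≥0 :=
  sSup {y : ℝ≥0 | (y : ℝ) ≤ ∑ j, ((r j).2.2.map fun p =>
    if p.1 = i then min (hitValue f N u (r j) p) (y / L) else 0).sum}

/-- The estimated priority of coordinate `i`. -/
noncomputable def score (N : ℕ) (L : ℝ) (u : Fin n → Fin n) (r : Fin s → Report n D)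
    (i : Fin n) : ℝ :=
  f (entryEstimate f N L u r i / 4) * rankWeight u i

open Classical in
/-- The elements of rank at most `M` in the order of decreasing values. -/
noncomputable def topRanked (M : ℕ) (v : Fin n → ℝ) : Finset (Fin n) :=
  {i | (Finset.univ.filter fun l => v i ≤ v l).card ≤ M}

/-- With ties allowed, all selected elements lie in the upper level set of the selected element of
least value. -/
lemma card_topRanked_le (M : ℕ) (v : Fin n → ℝ) : (topRanked M v).card ≤ M := by
  classical
  rcases (topRanked M v).eq_empty_or_nonempty with h | h
  · simp [h]
  · obtain ⟨i, hi, hmin⟩ := Finset.exists_min_image _ v h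
    have hi' : (Finset.univ.filter fun l => v i ≤ v l).card ≤ M := by
      simpa [topRanked] using hi
    exact (Finset.card_le_card fun l hl => by simpa using hmin l hl).trans hi'

/-- Markov counting. The order uses the computable scores v, while the mass is that of the true
priorities w ≥ v. -/
lemma mem_topRanked {M : ℕ} {v w : Fin n → ℝ} (hw : ∀ i, 0 ≤ w i) (hvw : ∀ i, v i ≤ w i)
    {i : Fin n} (hi : 0 < v i) (h : ∑ l, w l ≤ M * v i) : i ∈ topRanked M v := by
  classical
  simp only [topRanked, Finset.mem_filter, Finset.mem_univ, true_and]
  have h1 : ((Finset.univ.filter fun l => v i ≤ v l).card : ℝ) * v i ≤ M * v i := by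
    calc _ = ∑ _l ∈ Finset.univ.filter fun l => v i ≤ v l, v i := by simp
      _ ≤ ∑ l ∈ Finset.univ.filter fun l => v i ≤ v l, w l :=
          Finset.sum_le_sum fun l hl => (Finset.mem_filter.mp hl).2.trans (hvw l)
      _ ≤ ∑ l, w l := Finset.sum_le_sum_of_subset_of_nonneg (Finset.filter_subset _ _)
          fun l _ _ => hw l
      _ ≤ _ := h
  exact_mod_cast le_of_mul_le_mul_right h1 hi

/-- A word cannot hold an arbitrary real total. The ratio of the total to the largest weight lies in
[1, n], so its ceiling, minus 1, fits into an index and loses at most a factor 2. -/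
lemma exists_reference [NeZero n] {w : Fin n → ℝ} (hw : ∀ i, 0 ≤ w i) :
    ∃ i k : Fin n, ∑ l, w l ≤ ((k : ℝ) + 1) * w i ∧ ((k : ℝ) + 1) * w i ≤ 2 * ∑ l, w l := by
  obtain ⟨i, -, hi⟩ := Finset.exists_max_image Finset.univ w Finset.univ_nonempty
  have h1 : w i ≤ ∑ l, w l := Finset.single_le_sum (fun l _ => hw l) (Finset.mem_univ i)
  have h2 : ∑ l, w l ≤ n * w i := by
    calc ∑ l, w l ≤ ∑ _l : Fin n, w i := Finset.sum_le_sum fun l hl => hi l hl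
      _ = _ := by simp
  have hn := NeZero.pos n
  rcases (hw i).eq_or_lt with h0 | h0
  · refine ⟨i, i, ?_, ?_⟩
    · rw [← h0] at h2 ⊢; simpa using h2
    · rw [← h0] at h1 ⊢; simpa using h1
  · set r := (∑ l, w l) / w i with hr
    have hr1 : 1 ≤ r := (one_le_div h0).mpr h1
    have hrn : r ≤ n := (div_le_iff₀ h0).mpr h2
    have hre : r * w i = ∑ l, w l := div_mul_cancel₀ _ h0.ne'
    have hc1 : 1 ≤ ⌈r⌉₊ := Nat.one_le_ceil_iff.mpr (by linarith)
    have hc2 : ⌈r⌉₊ ≤ n := Nat.ceil_le.mpr hrn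
    have hcast : (((⌈r⌉₊ - 1 : ℕ) : ℝ) + 1) = ⌈r⌉₊ := by
      rw [Nat.cast_sub hc1]; simp
    refine ⟨i, ⟨⌈r⌉₊ - 1, by omega⟩, ?_, ?_⟩
    · simp only [hcast]
      rw [← hre]
      exact mul_le_mul_of_nonneg_right (Nat.le_ceil r) h0.le
    · simp only [hcast]
      rw [← hre]
      have := Nat.ceil_lt_add_one (a := r) (by linarith)
      nlinarith

lemma exists_report_data [NeZero n] (u : Fin n → Fin n) (x : Fin n → D) :
    ∃ (i₀ k : Fin n) (σ : ℝ → Option (Fin n)),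
      ∑ i, (f (x i) : ℝ) * rankWeight u i ≤ ((k : ℝ) + 1) * (f (x i₀) * rankWeight u i₀) ∧
      ((k : ℝ) + 1) * (f (x i₀) * rankWeight u i₀) ≤ 2 * ∑ i, (f (x i) : ℝ) * rankWeight u i ∧
      ∀ i, MeasurableSet {v | σ v = some i} ∧ uniformUnit.real {v | σ v = some i} =
        f (x i) * rankWeight u i / (((k : ℝ) + 1) * (f (x i₀) * rankWeight u i₀)) := by
  have hw : ∀ i, 0 ≤ (f (x i) : ℝ) * rankWeight u i := fun i =>
    mul_nonneg (NNReal.coe_nonneg _) (rankWeight_nonneg u i)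
  obtain ⟨i₀, k, h1, h2⟩ := exists_reference hw
  have hT : 0 ≤ ((k : ℝ) + 1) * (f (x i₀) * rankWeight u i₀) :=
    (Finset.sum_nonneg fun i _ => hw i).trans h1
  obtain ⟨σ, hσ⟩ := exists_sampler
    (fun i => (f (x i) : ℝ) * rankWeight u i / (((k : ℝ) + 1) * (f (x i₀) * rankWeight u i₀)))
    (fun i => div_nonneg (hw i) hT)
    (by rw [← Finset.sum_div]; exact div_le_one_of_le₀ h1 hT)
  exact ⟨i₀, k, σ, h1, h2, hσ⟩

lemma sum_map_filterMap_sample {ι : Type*} [DecidableEq ι] {α : Type*} (x : ι → α)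
    (g : Fin N → Option ι) (φ : ι × α → ℝ) (i : ι) :
    (((List.finRange N).filterMap fun t => (g t).map fun l => (l, x l)).map fun p =>
      if p.1 = i then φ p else 0).sum = ∑ t, if g t = some i then φ (i, x i) else 0 := by
  rw [← List.sum_ofFn, List.ofFn_eq_map]
  induction List.finRange N with
  | nil => simp
  | cons t l ih =>
    rw [List.filterMap_cons]
    cases h : g t with
    | none => simpa [h] using ih
    | some m =>
      simp only [Option.map_some, List.map_cons, List.sum_cons, ih, h, Option.some.injEq]
      congr 1
      split_ifs with hm
      · rw [hm]
      · rfl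

end Reports

/-! ### Monotonicity of clipped sums in the clip. -/

section ClippedSum

variable {s N : ℕ} {Y : Type*}

/-- The ratio min(z, b)/b decreases in b. -/
lemma clippedSum_scale (A : Fin s → Set Y) {z : Fin s → ℝ} (hz : ∀ j, 0 ≤ z j)
    (v : Fin s × Fin N → Y) {b b' : ℝ} (hb' : 0 ≤ b') (h : b' ≤ b) :
    b' * clippedSum A z b v ≤ b * clippedSum A z b' v := by
  unfold clippedSum
  rw [Finset.mul_sum, Finset.mul_sum]
  refine Finset.sum_le_sum fun p _ => ?_
  split_ifs with hp
  · have h0 := hz p.1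
    rcases le_total (z p.1) b' with h1 | h1
    · rw [min_eq_left h1, min_eq_left (h1.trans h)]
      gcongr
    · rw [min_eq_right h1, mul_comm b]
      exact mul_le_mul_of_nonneg_left (min_le_right _ _) hb'
  · simp

/-- The values y accepted by the test form a down-set, so one test at 4X controls all larger y. -/
lemma le_clippedSum_of_le (A : Fin s → Set Y) {z : Fin s → ℝ} (hz : ∀ j, 0 ≤ z j)
    (v : Fin s × Fin N → Y) {L y y' : ℝ} (hL : 0 < L) (hy' : 0 ≤ y') (h : y' ≤ y) (hy : 0 < y)
    (hc : y ≤ clippedSum A z (y / L) v) : y' ≤ clippedSum A z (y' / L) v := by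
  have h1 := clippedSum_scale A hz v (b := y / L) (b' := y' / L) (by positivity) (by gcongr)
  have h2 : y' / L * y ≤ y / L * clippedSum A z (y' / L) v :=
    (mul_le_mul_of_nonneg_left hc (by positivity)).trans h1
  have h3 : y / L * y' ≤ y / L * clippedSum A z (y' / L) v := by
    calc y / L * y' = y' / L * y := by ring
      _ ≤ _ := h2
  exact le_of_mul_le_mul_left h3 (by positivity)

lemma clippedSum_le_total (A : Fin s → Set Y) {z : Fin s → ℝ} (hz : ∀ j, 0 ≤ z j)
    (v : Fin s × Fin N → Y) (b : ℝ) : clippedSum A z b v ≤ ∑ p : Fin s × Fin N, z p.1 := by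
  refine Finset.sum_le_sum fun p _ => ?_
  split_ifs
  · exact min_le_left _ _
  · exact hz _

end ClippedSum

/-! ### Heavy coordinates are sampled well and estimated within constant factors. -/

section Concentration

variable {n s N : ℕ} {f : ℝ≥0 → ℝ≥0} {θ θ' θ'' : ℝ≥0}

/-- If `∑ i, f (X i) ρ i` is not much larger than the priority `f (∑ j, x j) ρ` of a coordinate,
then the entries which are sampled with sufficient rate make up half of that coordinate. -/
lemma half_le_sum_good (h : ApproxInvertible f θ θ' θ'') (hf : Monotone f) (hs : 1 ≤ s)
    (x : Fin s → ℝ≥0) {q T : Fin s → ℝ} {ρ L V : ℝ} (hρ : 0 ≤ ρ)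
    (hq : ∀ j, 0 ≤ q j) (hT : ∀ j, 0 ≤ T j) (hqT : ∀ j, q j * T j = f (x j) * ρ)
    (hV : ∑ j, T j ≤ V) (hN : 8 * L * θ'' * cf f s * V < N * s * (f (∑ j, x j) * ρ))
    (G : Finset (Fin s)) (hG : ∀ j, j ∉ G → N * q j * (∑ j, x j : ℝ≥0) ≤ 8 * L * x j)
    (hL : 0 ≤ L) :
    ((∑ j, x j : ℝ≥0) : ℝ) / 2 ≤ ∑ j ∈ G, (x j : ℝ) := by
  by_contra hcon
  push Not at hcon
  set X : ℝ≥0 := ∑ j, x j with hX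
  set Z : ℝ≥0 := ∑ j ∈ Gᶜ, x j with hZ
  have hGZ : (∑ j ∈ G, (x j : ℝ)) + Z = X := by
    rw [hZ, hX]
    push_cast
    exact Finset.sum_add_sum_compl G fun j => (x j : ℝ)
  -- The servers outside G hold more than half of X, so passing from X to Z costs one factor θ''.
  have hXZ : X ≤ 4 ^ 1 * Z := by
    rw [← NNReal.coe_le_coe]
    push_cast
    have := NNReal.coe_nonneg Z
    linarith
  have h1 : (f X : ℝ) ≤ θ'' * f Z := by
    have := h.le_pow_mul_map_of_le hf 1 hXZ
    rw [pow_one] at this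
    exact_mod_cast this
  have h2 : (f Z : ℝ) ≤ cf f s / s * (∑ j ∈ Gᶜ, Real.sqrt (f (x j))) ^ 2 := by
    have h3 := h.map_sum_le_cf hf hs fun j => if j ∈ Gᶜ then x j else 0
    have e1 : ∑ j, (if j ∈ Gᶜ then x j else 0) = Z := by
      rw [← Finset.sum_filter, Finset.filter_mem_eq_inter, Finset.univ_inter]
    have e2 : ∑ j, NNReal.sqrt (f (if j ∈ Gᶜ then x j else 0))
        = ∑ j ∈ Gᶜ, NNReal.sqrt (f (x j)) := by
      rw [← Finset.univ_inter Gᶜ, ← Finset.filter_mem_eq_inter, Finset.sum_filter]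
      refine Finset.sum_congr rfl fun j _ => ?_
      simp only [Finset.mem_filter, Finset.mem_univ, true_and]
      split_ifs <;> simp [h.map_zero]
    rw [e1, e2] at h3
    have h4 := NNReal.coe_le_coe.mpr h3
    push_cast [Real.coe_sqrt] at h4
    exact h4
  have hs0 : (0 : ℝ) < s := by exact_mod_cast hs
  -- Cauchy–Schwarz with √(f(x j) ρ) = √(q j) √(T j).
  have hcs : ρ * (∑ j ∈ Gᶜ, Real.sqrt (f (x j))) ^ 2 ≤ (∑ j ∈ Gᶜ, q j) * V := by
    have e1 : ρ * (∑ j ∈ Gᶜ, Real.sqrt (f (x j))) ^ 2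
        = (∑ j ∈ Gᶜ, Real.sqrt (q j) * Real.sqrt (T j)) ^ 2 := by
      have : ∀ j, Real.sqrt (q j) * Real.sqrt (T j) = Real.sqrt ρ * Real.sqrt (f (x j)) := by
        intro j
        rw [← Real.sqrt_mul (hq j), hqT, mul_comm, Real.sqrt_mul hρ]
      simp only [this]
      rw [← Finset.mul_sum, mul_pow, Real.sq_sqrt hρ]
    rw [e1]
    refine (Finset.sum_mul_sq_le_sq_mul_sq _ _ _).trans ?_
    simp only [Real.sq_sqrt (hq _), Real.sq_sqrt (hT _)]
    have hTc : ∑ j ∈ Gᶜ, T j ≤ V := (Finset.sum_le_sum_of_subset_of_nonneg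
      (Finset.subset_univ _) fun j _ _ => hT j).trans hV
    exact mul_le_mul_of_nonneg_left hTc (Finset.sum_nonneg fun j _ => hq j)
  have hV0 : 0 ≤ V := (Finset.sum_nonneg fun j _ => hT j).trans hV
  have hXpos : (0 : ℝ) < X := by
    rcases (NNReal.coe_nonneg X).eq_or_lt with h0 | h0
    · exfalso
      have hG0 : 0 ≤ ∑ j ∈ G, (x j : ℝ) := Finset.sum_nonneg fun j _ => NNReal.coe_nonneg _
      rw [← h0] at hcon
      linarith
    · exact h0
  -- Each server outside G expects at most 8L x j / X hits, hence all together at most 8L.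
  have hbad : N * ∑ j ∈ Gᶜ, q j ≤ 8 * L := by
    have : (N * ∑ j ∈ Gᶜ, q j) * X ≤ 8 * L * X := by
      calc (N * ∑ j ∈ Gᶜ, q j) * X = ∑ j ∈ Gᶜ, N * q j * X := by
            rw [Finset.mul_sum, Finset.sum_mul]
        _ ≤ ∑ j ∈ Gᶜ, 8 * L * (x j : ℝ) :=
            Finset.sum_le_sum fun j hj => hG j (Finset.mem_compl.mp hj)
        _ = 8 * L * Z := by rw [← Finset.mul_sum, hZ]; push_cast; rfl
        _ ≤ 8 * L * X := by
            have hG0 : 0 ≤ ∑ j ∈ G, (x j : ℝ) := Finset.sum_nonneg fun j _ => NNReal.coe_nonneg _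
            gcongr
            rw [← NNReal.coe_le_coe]
            linarith
    exact le_of_mul_le_mul_right this hXpos
  have : N * s * (f X * ρ) ≤ 8 * L * θ'' * cf f s * V := by
    calc (N : ℝ) * s * (f X * ρ) ≤
          N * s * (θ'' * (cf f s / s * (∑ j ∈ Gᶜ, Real.sqrt (f (x j))) ^ 2) * ρ) := by
          gcongr
          exact h1.trans (by gcongr)
      _ = N * (θ'' * cf f s) * (ρ * (∑ j ∈ Gᶜ, Real.sqrt (f (x j))) ^ 2) := by
          field_simp
      _ ≤ N * (θ'' * cf f s) * ((∑ j ∈ Gᶜ, q j) * V) := by gcongr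
      _ = (θ'' * cf f s) * V * (N * ∑ j ∈ Gᶜ, q j) := by ring
      _ ≤ (θ'' * cf f s) * V * (8 * L) := by gcongr
      _ = _ := by ring
  linarith

/-- With high probability the clipped sums bound every coordinate from above, and every coordinate
of high priority from below. -/
lemma measure_bad_samples_le (h : ApproxInvertible f θ θ' θ'') (hf : Monotone f) (hs : 1 ≤ s)
    {Y : Type*} [MeasurableSpace Y] (ν : Measure Y) [IsProbabilityMeasure ν]
    (x : Fin s → Fin n → ℝ≥0) {ρ : Fin n → ℝ} (hρ : ∀ i, 0 ≤ ρ i) {T : Fin s → ℝ}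
    (hT : ∀ j, ∑ i, f (x j i) * ρ i ≤ T j) (hT2 : ∀ j, T j ≤ 2 * ∑ i, f (x j i) * ρ i)
    (A : Fin s → Fin n → Set Y) (hA : ∀ j i, MeasurableSet (A j i))
    (hν : ∀ j i, ν.real (A j i) = f (x j i) * ρ i / T j) {L τ : ℝ} (hL : 0 < L) (hτ : 0 < τ)
    (hN : 16 * L * θ'' * cf f s * ∑ i, f (∑ j, x j i) * ρ i < N * s * τ) :
    (Measure.pi fun _ : Fin s × Fin N => ν).real
      {v | ∃ i, (∃ y : ℝ≥0, 4 * ∑ j, x j i < y ∧ (y : ℝ) ≤ clippedSum (fun j => A j i)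
          (fun j => x j i / (N * ν.real (A j i))) (y / L) v) ∨
        (τ ≤ f (∑ j, x j i) * ρ i ∧ ¬ ((∑ j, (x j i : ℝ)) / 8 ≤ clippedSum (fun j => A j i)
          (fun j => x j i / (N * ν.real (A j i))) ((∑ j, (x j i : ℝ)) / 8 / L) v))} ≤
      2 * n * Real.exp (-(L / 2)) := by
  set μ := Measure.pi fun _ : Fin s × Fin N => ν
  have hw : ∀ j i, 0 ≤ (f (x j i) : ℝ) * ρ i := fun j i =>
    mul_nonneg (NNReal.coe_nonneg _) (hρ i)
  have hT0 : ∀ j, 0 ≤ T j := fun j => (Finset.sum_nonneg fun i _ => hw j i).trans (hT j)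
  have hz0 : ∀ i j, (0 : ℝ) ≤ x j i / (N * ν.real (A j i)) := fun i j => by positivity
  set B1 : Fin n → Set (Fin s × Fin N → Y) := fun i =>
    {v | ∃ y : ℝ≥0, 4 * ∑ j, x j i < y ∧ (y : ℝ) ≤ clippedSum (fun j => A j i)
      (fun j => x j i / (N * ν.real (A j i))) (y / L) v} with hB1
  set B2 : Fin n → Set (Fin s × Fin N → Y) := fun i =>
    {v | τ ≤ f (∑ j, x j i) * ρ i ∧ ¬ ((∑ j, (x j i : ℝ)) / 8 ≤ clippedSum (fun j => A j i)
      (fun j => x j i / (N * ν.real (A j i))) ((∑ j, (x j i : ℝ)) / 8 / L) v)} with hB2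
  have hb1 : ∀ i, μ.real (B1 i) ≤ Real.exp (-(L / 2)) := by
    intro i
    -- If X_i = 0, the test value 4X_i vanishes and Chernoff is not available, but then all hit
    -- values are 0.
    rcases (zero_le (a := ∑ j, x j i)).eq_or_lt with h0 | h0
    · have hx0 : ∀ j, x j i = 0 := fun j =>
        Finset.sum_eq_zero_iff.mp h0.symm j (Finset.mem_univ j)
      have : B1 i = ∅ := by
        rw [Set.eq_empty_iff_forall_notMem]
        rintro v ⟨y, hy, hy'⟩
        have hle := hy'.trans (clippedSum_le_total _ (hz0 i) v _)
        simp only [hx0, NNReal.coe_zero, zero_div, Finset.sum_const_zero] at hle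
        rw [← h0, mul_zero] at hy
        exact absurd hle (not_le.mpr (by exact_mod_cast hy))
      rw [this, measureReal_empty]
      exact (Real.exp_pos _).le
    · have h0' : (0 : ℝ) < ∑ j, (x j i : ℝ) := by exact_mod_cast h0
      refine (measureReal_mono ?_).trans (clippedSum_upper (N := N) ν (fun j => A j i)
        (fun j => hA j i) (x := fun j => (x j i : ℝ)) (fun j => NNReal.coe_nonneg _) hL
        (y := 4 * ∑ j, (x j i : ℝ)) (by positivity) le_rfl)
      rintro v ⟨y, hy, hy'⟩
      have hyr : 4 * ∑ j, (x j i : ℝ) < y := by exact_mod_cast hy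
      exact le_clippedSum_of_le _ (hz0 i) v hL (by positivity) hyr.le (by linarith) hy'
  have hb2 : ∀ i, μ.real (B2 i) ≤ Real.exp (-(L / 2)) := by
    intro i
    by_cases hτi : τ ≤ f (∑ j, x j i) * ρ i
    · have hXpos : (0 : ℝ) < ∑ j, (x j i : ℝ) := by
        rcases (zero_le (a := ∑ j, x j i)).eq_or_lt with h0 | h0
        · rw [← h0, h.map_zero, NNReal.coe_zero, zero_mul] at hτi
          exact absurd hτ (not_lt.mpr hτi)
        · exact_mod_cast h0
      classical
      -- Exactly the servers whose hits are not clipped when the tested value is X_i/8.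
      set G : Finset (Fin s) := Finset.univ.filter fun j =>
        8 * L * (x j i : ℝ) ≤ N * ν.real (A j i) * (∑ j, x j i : ℝ≥0) with hG
      have hhalf := half_le_sum_good (N := N) h hf hs (fun j => x j i)
        (q := fun j => ν.real (A j i)) (T := T) (ρ := ρ i) (L := L)
        (V := 2 * ∑ i, f (∑ j, x j i) * ρ i) (hρ i) (fun j => measureReal_nonneg) hT0
        (fun j => by
          rw [hν]
          rcases eq_or_ne (T j) 0 with h0 | h0
          · have hle : (f (x j i) : ℝ) * ρ i ≤ 0 :=
              (Finset.single_le_sum (fun i _ => hw j i) (Finset.mem_univ i)).trans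
                ((hT j).trans_eq h0)
            rw [h0, mul_zero]
            exact le_antisymm (hw j i) hle
          · exact div_mul_cancel₀ _ h0)
        -- The reported totals lose a factor 2; super-additivity bounds the servers' weights by the
        -- priorities of the sum.
        (by
          calc ∑ j, T j ≤ ∑ j, 2 * ∑ i, (f (x j i) : ℝ) * ρ i :=
                Finset.sum_le_sum fun j _ => hT2 j
            _ = 2 * ∑ i, (∑ j, (f (x j i) : ℝ)) * ρ i := by
                rw [← Finset.mul_sum, Finset.sum_comm]
                simp only [Finset.sum_mul]
            _ ≤ 2 * ∑ i, f (∑ j, x j i) * ρ i := by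
                gcongr with i
                · exact hρ i
                · exact_mod_cast h.sum_le Finset.univ fun j => x j i)
        (by
          calc _ = 16 * L * θ'' * cf f s * ∑ i, f (∑ j, x j i) * ρ i := by ring
            _ < N * s * τ := hN
            _ ≤ _ := by gcongr)
        G (fun j hj => by
          simp only [hG, Finset.mem_filter, Finset.mem_univ, true_and, not_le] at hj
          exact hj.le) hL.le
      refine (measureReal_mono ?_).trans (clippedSum_lower (N := N) ν (fun j => A j i)
        (fun j => hA j i) (x := fun j => (x j i : ℝ)) (fun j => NNReal.coe_nonneg _) hL
        (y := (∑ j, (x j i : ℝ)) / 8) (by positivity) G (fun j hj => by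
          simp only [hG, Finset.mem_filter, Finset.mem_univ, true_and] at hj
          push_cast at hj
          linarith) (by push_cast at hhalf; linarith))
      exact fun v hv => hv.2
    · have : B2 i = ∅ := by
        rw [Set.eq_empty_iff_forall_notMem]
        exact fun v hv => hτi hv.1
      rw [this, measureReal_empty]
      exact (Real.exp_pos _).le
  have hsub : {v | ∃ i, v ∈ B1 i ∨ v ∈ B2 i} ⊆ ⋃ i ∈ (Finset.univ : Finset (Fin n)),
      (B1 i ∪ B2 i) := by
    rintro v ⟨i, hi⟩
    exact Set.mem_biUnion (Finset.mem_coe.mpr (Finset.mem_univ i)) hi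
  refine (measureReal_mono hsub (measure_ne_top μ _)).trans ((measureReal_biUnion_finset_le _ _).trans ?_)
  calc ∑ i, μ.real (B1 i ∪ B2 i) ≤ ∑ _i : Fin n, 2 * Real.exp (-(L / 2)) := by
        refine Finset.sum_le_sum fun i _ => (measureReal_union_le _ _).trans ?_
        linarith [hb1 i, hb2 i]
    _ = _ := by simp; ring

end Concentration

/-! ### Assembling the protocol. -/

/-- A product event whose sections are controlled outside a small set. -/
lemma exists_good_event {U V : Type*} [MeasurableSpace U] [Countable U]
    [MeasurableSingletonClass U] [MeasurableSpace V] (μ : Measure U) (ν : Measure V)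
    [IsProbabilityMeasure μ] [IsProbabilityMeasure ν] (bad : Set U) (bad' : U → Set V)
    (h : μ.real bad ≤ 1 / 20) (h' : ∀ u ∉ bad, ν.real (bad' u) ≤ 1 / 20) :
    ∃ E : Set (U × V), MeasurableSet E ∧ 9 / 10 ≤ (μ.prod ν) E ∧
      ∀ ω ∈ E, ω.1 ∉ bad ∧ ω.2 ∉ bad' ω.1 := by
  -- The sections of the bad event need not be measurable, so they are replaced by measurable hulls;
  -- countability of U makes the union measurable. Finally (19/20)² ≥ 9/10.
  set E : Set (U × V) := ⋃ u ∈ badᶜ, {u} ×ˢ (toMeasurable ν (bad' u))ᶜ with hE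
  have hEm : MeasurableSet E := MeasurableSet.biUnion (Set.to_countable _) fun u _ =>
    (measurableSet_singleton u).prod (measurableSet_toMeasurable _ _).compl
  have hbm : MeasurableSet bad := (Set.to_countable bad).measurableSet
  refine ⟨E, hEm, ?_, ?_⟩
  · have h1 : ENNReal.ofReal (19 / 20) ≤ μ badᶜ := by
      rw [← ofReal_measureReal (measure_ne_top _ _)]
      apply ENNReal.ofReal_le_ofReal
      rw [probReal_compl_eq_one_sub hbm]
      linarith
    have h2 : ∀ u ∈ badᶜ, ENNReal.ofReal (19 / 20) ≤ ν (Prod.mk u ⁻¹' E) := by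
      intro u hu
      have hsub : (toMeasurable ν (bad' u))ᶜ ⊆ Prod.mk u ⁻¹' E := fun v hv =>
        Set.mem_biUnion hu ⟨rfl, hv⟩
      refine le_trans ?_ (measure_mono hsub)
      rw [← ofReal_measureReal (measure_ne_top _ _)]
      apply ENNReal.ofReal_le_ofReal
      rw [probReal_compl_eq_one_sub (measurableSet_toMeasurable _ _), measureReal_def,
        measure_toMeasurable, ← measureReal_def]
      linarith [h' u hu]
    rw [Measure.prod_apply hEm]
    calc (9 / 10 : ℝ≥0∞) ≤ ENNReal.ofReal (19 / 20) * ENNReal.ofReal (19 / 20) := by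
          rw [← ENNReal.ofReal_mul (by norm_num)]
          rw [show (9 / 10 : ℝ≥0∞) = ENNReal.ofReal (9 / 10) by
            rw [ENNReal.ofReal_div_of_pos (by norm_num)]; norm_num]
          apply ENNReal.ofReal_le_ofReal
          norm_num
      _ ≤ ENNReal.ofReal (19 / 20) * μ badᶜ := by gcongr
      _ = ∫⁻ _u in badᶜ, ENNReal.ofReal (19 / 20) ∂μ := by rw [setLIntegral_const]
      _ ≤ ∫⁻ u in badᶜ, ν (Prod.mk u ⁻¹' E) ∂μ := setLIntegral_mono' hbm.compl h2
      _ ≤ ∫⁻ u, ν (Prod.mk u ⁻¹' E) ∂μ := setLIntegral_le_lintegral _ _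
  · rintro ⟨u, v⟩ hω
    simp only [hE, Set.mem_iUnion, Set.mem_prod, Set.mem_singleton_iff] at hω
    obtain ⟨u', hu', rfl, hv⟩ := hω
    exact ⟨hu', fun hc => hv (subset_toMeasurable _ _ hc)⟩

lemma crossingEstimate_zero {n : ℕ} (K : ℝ) (u : Fin n → Fin n) :
    crossingEstimate K (fun _ => 0) u = 0 := by
  unfold crossingEstimate thresholdEstimate
  split_ifs <;> simp

/-- For L = 20 log n each tail is n^(-10), which pays for the union over 2n events. -/
lemma two_mul_exp_neg_log_le {n : ℕ} (hn : 2 ≤ n) :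
    2 * n * Real.exp (-(20 * Real.log n / 2)) ≤ 1 / 20 := by
  have hn0 : (2 : ℝ) ≤ n := by exact_mod_cast hn
  have e1 : Real.exp (-(20 * Real.log n / 2)) = ((n : ℝ) ^ 10)⁻¹ := by
    rw [Real.exp_neg, show 20 * Real.log n / 2 = ((10 : ℕ) : ℝ) * Real.log n by push_cast; ring,
      Real.exp_nat_mul, Real.exp_log (by linarith)]
  rw [e1, ← div_eq_mul_inv, div_le_div_iff₀ (by positivity) (by norm_num)]
  have h9 : (2 : ℝ) ^ 9 ≤ n ^ 9 := by gcongr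
  have : (n : ℝ) ^ 10 = n ^ 9 * n := by ring
  nlinarith

/-- Membership in the set that defines an entry estimate, in terms of the clipped sums. -/
lemma sum_report_eq_clippedSum {n s N : ℕ} {D : Set ℝ≥0} (f : ℝ≥0 → ℝ≥0) (u : Fin n → Fin n)
    (x : Fin s → Fin n → D) (i₀ k : Fin s → Fin n) (σ : Fin s → ℝ → Option (Fin n))
    (hσ : ∀ j i, uniformUnit.real {v | σ j v = some i} = f (x j i) * rankWeight u i /
      (((k j : ℝ) + 1) * (f (x j (i₀ j)) * rankWeight u (i₀ j))))
    (v : Fin s × Fin N → ℝ) (i : Fin n) (b : ℝ) :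
    ∑ j, (((List.finRange N).filterMap fun t => (σ j (v (j, t))).map fun l => (l, x j l)).map
      fun p => if p.1 = i then min (hitValue f N u ((i₀ j, x j (i₀ j)), k j,
        (List.finRange N).filterMap fun t => (σ j (v (j, t))).map fun l => (l, x j l)) p) b
        else 0).sum =
    clippedSum (fun j => {v | σ j v = some i})
      (fun j => ((x j i : ℝ≥0) : ℝ) / (N * uniformUnit.real {v | σ j v = some i})) b v := by
  rw [clippedSum, Fintype.sum_prod_type]
  refine Finset.sum_congr rfl fun j _ => ?_
  rw [sum_map_filterMap_sample]
  refine Finset.sum_congr rfl fun t _ => ?_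
  simp only [hσ, hitValue, reportTotal, Set.mem_ofPred_eq]

/-- Outside the bad ranks, 10⁹(1 + log n)/ε² bounds the ratio of the total priority to τ; here 10⁹ =
50 · 2·10⁷ from `exists_good_ranks`. The factor 320 is 16 · 20, from `measure_bad_samples_le` and L
= 20 log n. -/
lemma exists_threshold_protocol {f : ℝ≥0 → ℝ≥0} {θ θ' θ'' : ℝ≥0} (hf : Monotone f)
    (h : ApproxInvertible f θ θ' θ'') {n s : ℕ} (hn : 2 ≤ n) (hs : 1 ≤ s) {ε : ℝ} (hε : 0 < ε)
    (hε1 : ε < 1) {D : Set ℝ≥0} [Nonempty D] {W : Type} (e : Fin n ↪ W) (e' : D ↪ W) {N M : ℕ}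
    (hN : 320 * Real.log n * θ'' * cf f s * (1000000000 * (1 + Real.log n) / ε ^ 2) < N * s)
    (hM : 1000000000 * (1 + Real.log n) / ε ^ 2 * θ'' ^ 3 ≤ M) :
    ∃ (Ω : Type) (_ : MeasurableSpace Ω) (μ : Measure Ω) (_ : IsProbabilityMeasure μ)
      (P : TwoRoundProtocol s n D W Ω), (∀ ω x, P.words ω x ≤ s * (3 + 2 * N + 2 * M)) ∧
        ∀ x : Fin s → Fin n → D, ∃ E : Set Ω, MeasurableSet E ∧ 9 / 10 ≤ μ E ∧
          ∀ ω ∈ E, |P.result ω x - sumOf f x| ≤ ε / 2 * sumOf f x := by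
  have : NeZero n := ⟨by omega⟩
  set l := Real.log n with hl
  have hlpos : 0 < l := Real.log_pos (by exact_mod_cast hn)
  set L := 20 * l with hL
  have hLpos : 0 < L := by positivity
  choose i₀ k σ hlow hup hσ using fun (u : Fin n → Fin n) (x : Fin n → D) =>
    exists_report_data f u x
  let rep : ((Fin n → Fin n) × (Fin s × Fin N → ℝ)) → Fin s → (Fin n → D) → Report n D :=
    fun ω j x => ((i₀ ω.1 x, x (i₀ ω.1 x)), k ω.1 x,
      (List.finRange N).filterMap fun t => (σ ω.1 x (ω.2 (j, t))).map fun i => (i, x i))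
  obtain ⟨P, hP, hres⟩ := exists_protocol (Nat.pos_of_neZero n) e e' N M rep
    (fun ω j x => (List.length_filterMap_le _ _).trans (by simp))
    (fun ω r => topRanked M (score f N L ω.1 r)) (fun ω r => card_topRanked_le _ _)
    (fun ω r y => crossingEstimate (1600000 / ε ^ 2) (fun i => (f (y i) : ℝ)) ω.1)
  refine ⟨_, inferInstance, (rankMeasure n).prod (Measure.pi fun _ => uniformUnit), inferInstance,
    P, hP, fun x => ?_⟩
  set X : Fin n → ℝ≥0 := fun i => ∑ j, (x j i : ℝ≥0) with hX
  set a : Fin n → ℝ := fun i => f (X i) with ha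
  have ha0 : ∀ i, 0 ≤ a i := fun i => NNReal.coe_nonneg _
  have hsum : ((sumOf f x : ℝ≥0) : ℝ) = ∑ i, a i := by simp [sumOf, ha, hX]
  rw [hsum]
  rcases (Finset.sum_nonneg fun i _ => ha0 i : 0 ≤ ∑ i, a i).eq_or_lt with hF | hF
  · refine ⟨Set.univ, MeasurableSet.univ, ?_, fun ω _ => ?_⟩
    · rw [measure_univ]
      exact ENNReal.div_le_of_le_mul (by norm_num)
    · have hz : ∀ i, a i = 0 := fun i =>
        (Finset.sum_eq_zero_iff_of_nonneg fun i _ => ha0 i).mp hF.symm i (Finset.mem_univ i)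
      rw [hres, ← hF]
      have : (fun i => ((f (if i ∈ topRanked M (score f N L ω.1 fun j => rep ω j (x j)) then
          ∑ j, (x j i : ℝ≥0) else 0) : ℝ≥0) : ℝ)) = fun _ => 0 := by
        ext i
        split_ifs
        · exact hz i
        · simp [h.map_zero]
      rw [this, crossingEstimate_zero]
      simp
  obtain ⟨τ, hτ, hτF, bad, hbad, hgood⟩ := exists_good_ranks ha0 hF hε hε1
  set c := 1000000000 * (1 + l) / ε ^ 2 with hc
  have hweight : ∀ u ∉ bad, ∑ i, a i * rankWeight u i ≤ c * τ := by
    intro u hu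
    refine (hgood u hu).1.trans ?_
    rw [hc, div_mul_eq_mul_div, le_div_iff₀ (by positivity)]
    nlinarith [mul_le_mul_of_nonneg_right hτF (by positivity : (0 : ℝ) ≤ 1 + l)]
  set A : (Fin n → Fin n) → Fin s → Fin n → Set ℝ := fun u j i => {v | σ u (x j) v = some i}
  set z : (Fin n → Fin n) → Fin n → Fin s → ℝ := fun u i j =>
    ((x j i : ℝ≥0) : ℝ) / (N * uniformUnit.real (A u j i)) with hz
  have hz0 : ∀ u i j, 0 ≤ z u i j := fun u i j => by
    simp only [hz]; positivity
  obtain ⟨E, hE, hE9, hEgood⟩ := exists_good_event (rankMeasure n)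
    (Measure.pi fun _ : Fin s × Fin N => uniformUnit) bad
    (fun u => {v | ∃ i, (∃ y : ℝ≥0, 4 * ∑ j, (x j i : ℝ≥0) < y ∧
        (y : ℝ) ≤ clippedSum (fun j => A u j i) (z u i) (y / L) v) ∨
      (τ ≤ f (∑ j, (x j i : ℝ≥0)) * rankWeight u i ∧
        ¬ ((∑ j, ((x j i : ℝ≥0) : ℝ)) / 8 ≤ clippedSum (fun j => A u j i) (z u i)
          ((∑ j, ((x j i : ℝ≥0) : ℝ)) / 8 / L) v))}) hbad (by
      intro u hu
      refine (measure_bad_samples_le h hf hs uniformUnit (fun j i => (x j i : ℝ≥0))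
        (ρ := rankWeight u) (rankWeight_nonneg u) (fun j => hlow u (x j)) (fun j => hup u (x j))
        (A u) (fun j i => (hσ u (x j) i).1) (fun j i => (hσ u (x j) i).2) hLpos hτ ?_).trans
        (two_mul_exp_neg_log_le hn)
      calc 16 * L * θ'' * cf f s * ∑ i, a i * rankWeight u i
          ≤ 16 * L * θ'' * cf f s * (c * τ) := by gcongr; exact hweight u hu
        _ = 320 * l * θ'' * cf f s * c * τ := by rw [hL]; ring
        _ < N * s * τ := by gcongr)
  refine ⟨E, hE, hE9, fun ω hω => ?_⟩
  obtain ⟨u, v⟩ := ω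
  obtain ⟨hu, hv⟩ := hEgood _ hω
  simp only [Set.mem_ofPred_eq, not_exists, not_or, not_and, not_le] at hu hv
  rw [hres]
  set r : Fin s → Report n D := fun j => rep (u, v) j (x j) with hr
  have hset : ∀ i, {y : ℝ≥0 | (y : ℝ) ≤ ∑ j, ((r j).2.2.map fun p =>
      if p.1 = i then min (hitValue f N u (r j) p) (y / L) else 0).sum} =
      {y : ℝ≥0 | (y : ℝ) ≤ clippedSum (fun j => A u j i) (z u i) (y / L) v} := by
    intro i
    ext y
    have := sum_report_eq_clippedSum (N := N) f u x (fun j => i₀ u (x j)) (fun j => k u (x j))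
      (fun j => σ u (x j)) (fun j i => (hσ u (x j) i).2) v i (y / L)
    exact Iff.of_eq (congrArg (fun w : ℝ => (y : ℝ) ≤ w) this)
  have hest : ∀ i, entryEstimate f N L u r i =
      sSup {y : ℝ≥0 | (y : ℝ) ≤ clippedSum (fun j => A u j i) (z u i) (y / L) v} := fun i => by
    rw [entryEstimate, hset]
  have hupper : ∀ i, ∀ y ∈ {y : ℝ≥0 | (y : ℝ) ≤
      clippedSum (fun j => A u j i) (z u i) (y / L) v}, y ≤ 4 * X i := by
    intro i y hy
    by_contra hcon
    push Not at hcon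
    exact absurd hy (not_le.mpr ((hv i).1 y hcon))
  have hle : ∀ i, entryEstimate f N L u r i ≤ 4 * X i := by
    intro i
    rw [hest]
    exact csSup_le' (hupper i)
  have hge : ∀ i, τ ≤ a i * rankWeight u i → X i / 8 ≤ entryEstimate f N L u r i := by
    intro i hi
    rw [hest]
    -- Boundedness matters: the supremum of an unbounded set would default to 0.
    refine le_csSup ⟨4 * X i, hupper i⟩ ?_
    have := (hv i).2 hi
    simpa [hX] using this
  have hscore : ∀ i, score f N L u r i ≤ a i * rankWeight u i := by
    intro i
    refine mul_le_mul_of_nonneg_right ?_ (rankWeight_nonneg u i)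
    refine NNReal.coe_le_coe.mpr (hf ?_)
    rw [div_le_iff₀ (by norm_num), mul_comm]
    exact hle i
  have hscore' : ∀ i, τ ≤ a i * rankWeight u i → τ ≤ θ'' ^ 3 * score f N L u r i := by
    intro i hi
    refine hi.trans ?_
    have h1 : f (X i) ≤ θ'' ^ 3 * f (entryEstimate f N L u r i / 4) := by
      -- X_i is at most 8 times the estimate, that is 32 ≤ 4³ times its quarter.
      refine h.le_pow_mul_map_of_le hf 3 ?_
      have := hge i hi
      rw [← NNReal.coe_le_coe] at this ⊢
      push_cast at this ⊢
      have h0 := NNReal.coe_nonneg (X i)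
      linarith
    have h2 : a i ≤ θ'' ^ 3 * f (entryEstimate f N L u r i / 4) := by exact_mod_cast h1
    rw [score, ← mul_assoc]
    exact mul_le_mul_of_nonneg_right h2 (rankWeight_nonneg u i)
  have hθ : (0 : ℝ) < θ'' ^ 3 := by
    have : (0 : ℝ) < θ'' := by exact_mod_cast lt_trans one_pos h.one_lt_θ''
    positivity
  -- Zeroing the unqueried coordinates is harmless once all of priority at least τ are queried.
  refine (hgood u hu).2 _ fun i => ?_
  dsimp only
  by_cases hi : τ ≤ a i * rankWeight u i
  · left
    have hspos : 0 < score f N L u r i :=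
      pos_of_mul_pos_right (hτ.trans_le (hscore' i hi)) hθ.le
    have hc0 : 0 ≤ c := by positivity
    rw [if_pos (mem_topRanked (fun i => mul_nonneg (ha0 i) (rankWeight_nonneg u i)) hscore hspos ?_)]
    calc ∑ i, a i * rankWeight u i ≤ c * τ := hweight u hu
      _ ≤ c * (θ'' ^ 3 * score f N L u r i) := by gcongr; exact hscore' i hi
      _ = c * θ'' ^ 3 * score f N L u r i := by ring
      _ ≤ M * score f N L u r i := by gcongr
  · by_cases hm : i ∈ topRanked M (score f N L u r)
    · left
      rw [if_pos hm]
    · right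
      rw [if_neg hm]
      exact ⟨by simp [h.map_zero], not_le.mp hi⟩

/-! ### The degenerate case, the word count and the conclusion. -/

/-- If `f` vanishes on all inputs, nothing needs to be communicated. -/
lemma exists_trivial_protocol (s n : ℕ) (D : Set ℝ≥0) (W : Type) :
    ∃ (Ω : Type) (_ : MeasurableSpace Ω) (μ : Measure Ω) (_ : IsProbabilityMeasure μ)
      (P : TwoRoundProtocol s n D W Ω), (∀ ω x, P.words ω x = 0) ∧
        ∀ x, ∃ E : Set Ω, MeasurableSet E ∧ 9 / 10 ≤ μ E ∧ ∀ ω ∈ E, P.result ω x = 0 := by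
  refine ⟨Unit, inferInstance, Measure.dirac (), inferInstance,
    ⟨fun _ _ _ => [], fun _ _ _ => [], fun _ _ _ _ => [], fun _ _ _ => 0⟩, fun ω x => ?_,
    fun x => ⟨Set.univ, MeasurableSet.univ, ?_, fun _ _ => rfl⟩⟩
  · simp [TwoRoundProtocol.words, TwoRoundProtocol.msg₁, TwoRoundProtocol.reply,
      TwoRoundProtocol.msg₂]
  · rw [measure_univ]
    exact ENNReal.div_le_of_le_mul (by norm_num)

/-- The variable r stands for c_f[AB]·AB·√θ. As l = log n ≥ 1/2, constants and low powers of l are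
absorbed by l² and l⁴. -/
lemma words_bound {s l c θ ε r : ℝ} (hs : 1 ≤ s) (hl : 1 / 2 ≤ l) (hc : 0 ≤ c) (hθ : 1 ≤ θ)
    (hε : 0 < ε) (hε1 : ε < 1) (hr : 1 ≤ r) :
    s * (3 + 2 * (320 * l * θ * c * (1000000000 * (1 + l) / ε ^ 2) / s + 1) +
        2 * (1000000000 * (1 + l) / ε ^ 2 * θ ^ 3 + 1)) ≤
      10000000000000 * (c / ε ^ 2 * (r * θ ^ 3 * l ^ 4) + s / ε ^ 2 * (l ^ 2 * θ ^ 4)) := by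
  have hs0 : 0 < s := by linarith
  have hl0 : 0 < l := by linarith
  have hθ0 : 0 < θ := by linarith
  have e2 : 0 < ε ^ 2 := by positivity
  have e1 : ε ^ 2 ≤ 1 := pow_le_one₀ hε.le hε1.le
  have hl2 : 1 ≤ 4 * l ^ 2 := by nlinarith
  have h1l : (1 + l) * l ≤ 3 * l ^ 2 := by nlinarith
  have hθ2 : θ ≤ θ ^ 3 := le_self_pow₀ hθ (by norm_num)
  have hθ34 : θ ^ 3 ≤ θ ^ 4 := pow_le_pow_right₀ hθ (by norm_num)
  have hθ4 : 1 ≤ θ ^ 4 := one_le_pow₀ hθ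
  have key1 : 640000000000 * ((1 + l) * l * θ * c) ≤
      7680000000000 * (c * (r * θ ^ 3 * l ^ 4)) := by
    have h1 : (1 + l) * l * θ ≤ 12 * (r * θ ^ 3 * l ^ 4) := by
      calc (1 + l) * l * θ ≤ 3 * l ^ 2 * θ ^ 3 := by gcongr
        _ = 3 * (l ^ 2 * 1 * (1 * θ ^ 3)) := by ring
        _ ≤ 3 * (l ^ 2 * (4 * l ^ 2) * (r * θ ^ 3)) := by gcongr
        _ = _ := by ring
    nlinarith [mul_le_mul_of_nonneg_right h1 hc]
  have key2 : s * 7 ≤ s / ε ^ 2 * (28 * (l ^ 2 * θ ^ 4)) := by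
    have h1 : s ≤ s / ε ^ 2 := by
      rw [le_div_iff₀ e2]; nlinarith
    have h2 : 7 ≤ 28 * (l ^ 2 * θ ^ 4) := by nlinarith [mul_le_mul hl2 hθ4 zero_le_one (by positivity)]
    calc s * 7 ≤ s / ε ^ 2 * 7 := by gcongr
      _ ≤ _ := by gcongr
  have key3 : (1 + l) * θ ^ 3 ≤ 6 * (l ^ 2 * θ ^ 4) := by
    have h1 : 1 + l ≤ 6 * l ^ 2 := by nlinarith
    calc (1 + l) * θ ^ 3 ≤ 6 * l ^ 2 * θ ^ 4 := by gcongr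
      _ = _ := by ring
  calc _ = s * 7 + 640000000000 * ((1 + l) * l * θ * c) / ε ^ 2 +
        s / ε ^ 2 * (2000000000 * ((1 + l) * θ ^ 3)) := by field_simp; ring
    _ ≤ s / ε ^ 2 * (28 * (l ^ 2 * θ ^ 4)) +
        7680000000000 * (c * (r * θ ^ 3 * l ^ 4)) / ε ^ 2 +
        s / ε ^ 2 * (2000000000 * (6 * (l ^ 2 * θ ^ 4))) := by gcongr
    _ = 7680000000000 * (c / ε ^ 2 * (r * θ ^ 3 * l ^ 4)) +
        12000000028 * (s / ε ^ 2 * (l ^ 2 * θ ^ 4)) := by ring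
    _ ≤ _ := by
      have p1 : 0 ≤ c / ε ^ 2 * (r * θ ^ 3 * l ^ 4) := by positivity
      have p2 : 0 ≤ s / ε ^ 2 * (l ^ 2 * θ ^ 4) := by positivity
      linarith

theorem mainTheorem1 :
    ∃ a b C : ℝ, 0 < a ∧ 0 < b ∧ 0 < C ∧
      ∀ (f : ℝ≥0 → ℝ≥0) (θ θ' θ'' : ℝ≥0), Monotone f → ApproxInvertible f θ θ' θ'' →
      ∀ (n s : ℕ), 2 ≤ n → 1 ≤ s →
      ∀ ε : ℝ, 0 < ε → ε < 1 →
      -- the input entries lie in `D`; a word can hold an index from `[n]` or an element of `D`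
      ∀ (D : Set ℝ≥0) (W : Type), Nonempty (Fin n ↪ W) → Nonempty (D ↪ W) →
      ∀ A B : ℕ,
        A = ⌈a * (Real.log (s * θ'') / Real.log θ)⌉₊ →
        B = ⌈b * (Real.log (s ^ 2 * θ'' ^ 2) / Real.log θ)⌉₊ →
      ∃ (Ω : Type) (_ : MeasurableSpace Ω) (μ : Measure Ω) (_ : IsProbabilityMeasure μ)
        (P : TwoRoundProtocol s n D W Ω),
        (∀ (ω : Ω) (x : Fin s → Fin n → D), (P.words ω x : ℝ) ≤
          C * (cf f s / ε ^ 2 *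
                (cf f (A * B) * (A * B) * Real.sqrt θ * θ'' ^ 3 * Real.log n ^ 4)
              + s / ε ^ 2 * (Real.log n ^ 2 * θ'' ^ 4))) ∧
        ∀ x : Fin s → Fin n → D, ∃ E : Set Ω, MeasurableSet E ∧ 9 / 10 ≤ μ E ∧
          ∀ ω ∈ E, (1 - ε) * sumOf f x ≤ P.result ω x ∧ P.result ω x ≤ (1 + ε) * sumOf f x := by
  -- Any positive a and b would do: they serve only to make A and B at least 1.
  refine ⟨1, 1, 10000000000000, one_pos, one_pos, by norm_num, ?_⟩
  rintro f θ θ' θ'' hf h n s hn hs ε hε hε1 D W ⟨e⟩ ⟨e'⟩ A B hA hB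
  -- The remaining case supplies an element of D and a nonzero value of f, which `le_cf` needs.
  by_cases htriv : ∀ x : Fin s → Fin n → D, sumOf f x = 0
  · obtain ⟨Ω, _, μ, hμ, P, hP, hres⟩ := exists_trivial_protocol s n D W
    refine ⟨Ω, _, μ, hμ, P, fun ω x => ?_, fun x => ?_⟩
    · rw [hP, Nat.cast_zero]
      positivity
    · obtain ⟨E, hE, hE9, hE0⟩ := hres x
      refine ⟨E, hE, hE9, fun ω hω => ?_⟩
      rw [hE0 ω hω, htriv x]
      simp
  push Not at htriv
  obtain ⟨x₀, hx₀⟩ := htriv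
  have : Nonempty D := ⟨x₀ ⟨0, hs⟩ ⟨0, by omega⟩⟩
  obtain ⟨y₀, hy₀⟩ : ∃ y, f y ≠ 0 := by
    by_contra hcon
    push Not at hcon
    exact hx₀ (by simp [sumOf, hcon])
  have hs1 : (1 : ℝ) ≤ s := by exact_mod_cast hs
  have hs0 : (0 : ℝ) < s := by linarith
  have hθ1 : (1 : ℝ) < θ := by exact_mod_cast h.one_lt_θ
  have hθ''1 : (1 : ℝ) < θ'' := by exact_mod_cast h.one_lt_θ''
  have hl : 1 / 2 ≤ Real.log n := by
    have h1 : Real.log 2 ≤ Real.log n :=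
      Real.log_le_log (by norm_num) (by exact_mod_cast hn)
    have h2 := Real.log_two_gt_d9
    linarith
  have hsθ : 1 < (s : ℝ) * θ'' := by nlinarith
  have hA1 : 1 ≤ A := by
    rw [hA, Nat.one_le_ceil_iff, one_mul]
    exact div_pos (Real.log_pos hsθ) (Real.log_pos hθ1)
  have hB1 : 1 ≤ B := by
    rw [hB, Nat.one_le_ceil_iff, one_mul, ← mul_pow]
    exact div_pos (Real.log_pos (one_lt_pow₀ hsθ (by norm_num))) (Real.log_pos hθ1)
  have hAB : (1 : ℝ) ≤ A * B := by exact_mod_cast Nat.mul_pos hA1 hB1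
  have hr : 1 ≤ (cf f (A * B) : ℝ) * (A * B) * Real.sqrt θ := by
    have h1 : ((A * B : ℕ) : ℝ) ≤ cf f (A * B) := by
      exact_mod_cast h.le_cf hf (Nat.mul_pos hA1 hB1) hy₀
    push_cast at h1
    exact one_le_mul_of_one_le_of_one_le
      (one_le_mul_of_one_le_of_one_le (hAB.trans h1) hAB) (Real.one_le_sqrt.mpr hθ1.le)
  set t := 320 * Real.log n * θ'' * cf f s * (1000000000 * (1 + Real.log n) / ε ^ 2) with ht
  have ht0 : 0 ≤ t := by positivity
  set m := 1000000000 * (1 + Real.log n) / ε ^ 2 * (θ'' : ℝ) ^ 3 with hm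
  have hm0 : 0 ≤ m := by positivity
  obtain ⟨Ω, _, μ, hμ, P, hP, hres⟩ := exists_threshold_protocol hf h hn hs hε hε1 e e'
    (N := ⌊t / s⌋₊ + 1) (M := ⌊m⌋₊ + 1)
    (by
      rw [← div_lt_iff₀ hs0]
      push_cast
      exact Nat.lt_floor_add_one _)
    (by
      push_cast
      exact (Nat.lt_floor_add_one _).le)
  refine ⟨Ω, _, μ, hμ, P, fun ω x => ?_, fun x => ?_⟩
  · calc (P.words ω x : ℝ) ≤ s * (3 + 2 * (⌊t / s⌋₊ + 1 : ℝ) + 2 * (⌊m⌋₊ + 1 : ℝ)) := by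
          exact_mod_cast hP ω x
      _ ≤ s * (3 + 2 * (t / s + 1) + 2 * (m + 1)) := by
          gcongr
          · exact Nat.floor_le (by positivity)
          · exact Nat.floor_le hm0
      _ ≤ _ := words_bound hs1 hl (NNReal.coe_nonneg _) hθ''1.le hε hε1 hr
  · obtain ⟨E, hE, hE9, hEres⟩ := hres x
    refine ⟨E, hE, hE9, fun ω hω => ?_⟩
    have h1 := abs_le.mp (hEres ω hω)
    have h2 : 0 ≤ ε * (sumOf f x : ℝ) := by positivity
    constructor <;> nlinarith [h1.1, h1.2]
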